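/- Let $n\ge 2$ and let $\mathbb{R}^{2,n-2}$ be $\mathbb{R}^n$ with the inner product $g(x,y)=-x_1y_1-x_2y_2+x_3y_3+\dots+x_ny_n$. A vector $v$ is timelike if $g(v,v)<0$, lightlike if $v\neq0$ and $g(v,v)=0$, and causal if $v\ne 0$ and $g(v,v)\le 0$; a covector is called causal if its $g$-dual vector is. Write $v^\flat=g(v,\cdot)$. A nonzero $2$-form $\omega$ on $\mathbb{R}^{2,n-2}$ is of - Type $(I_a)$ if $\omega=l_1^\flat\wedge l_2^\flat$ for vectors $l_1,l_2$ spanning a totally lightlike plane; - Type $(I_b)$ if $\omega=l_1^\flat\wedge t_1^\flat$ with $l_1$ lightlike, $t_1$ timelike and $g(l_1,t_1)=0$; - Type $(II_a)$ if $\omega$ is a nonzero multiple of a (pseudo-)Kähler form on $\mathbb{R}^{2,n-2}$, that is, of $g(J\cdot,\cdot)$ for a $g$-orthogonal complex structure $J$; - Type $(II_b)$ if there is a nonzero positive definite subspace $E$ such that $x\lrcorner\omega=0$ for all $x\in E$ and $\omega$ restricted to $E^\perp$ is a nonzero multiple of a (pseudo-)Kähler form on $E^\perp$ (then $E$ is the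 kernel of $\omega$). Let $G$ be a subgroup of $O(2,n-2)$ and let $G_\omega$ be the stabilizer of $\omega$ in $G$. Consider the following two properties of a nonzero $2$-form $\omega$: 1. the covector $T\lrcorner\omega=\omega(T,\cdot)$ is causal for every timelike vector $T$; 2. there is no nonzero $2$-form $\eta$ with property 1 whose stabilizer $G_\eta$ properly contains $G_\omega$. Then for every nonzero $2$-form $\omega$ on $\mathbb{R}^{2,n-2}$: (i) for $G=O(2,n-2)$, $\omega$ has properties 1 and 2 if and only if it is of Type $(I_a)$, $(I_b)$, $(II_a)$ or $(II_b)$; (ii) for $G=SO(2,n-2)=\{h\in O(2,n-2):\det h=1\}$, $\omega$ has properties 1 and 2 if and only if it is of Type $(I_a)$, or of Type $(I_b)$ with $n\ne4$, or of Type $(II_a)$, or of Type $(II_b)$ with $\dim E\neq 2$. -/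

import Mathlib

/-- Signs of the standard orthonormal basis: `-1` for the first two vectors, `1` for the others. -/
def pseudoSign {n : ℕ} (i : Fin n) : ℝ := if i.val < 2 then -1 else 1

/-- The standard inner product `-x₁y₁ - x₂y₂ + x₃y₃ + ⋯ + xₙyₙ`; for `2 ≤ n` the space `Fin n → ℝ`
with this form is the pseudo-Euclidean space of signature `(2, n-2)`. -/
noncomputable def pseudoMetric (n : ℕ) : LinearMap.BilinForm ℝ (Fin n → ℝ) :=
  Matrix.toBilin' (Matrix.diagonal pseudoSign)

theorem pseudoMetric_apply (n : ℕ) (x y : Fin n → ℝ) :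
    pseudoMetric n x y = ∑ i, pseudoSign i * x i * y i := by
  simp only [pseudoMetric, Matrix.toBilin'_apply', Matrix.mulVec_diagonal, dotProduct]
  exact Finset.sum_congr rfl fun i _ => by ring

def IsTimelikeVec {n : ℕ} (v : Fin n → ℝ) : Prop := pseudoMetric n v v < 0

def IsLightlikeVec {n : ℕ} (v : Fin n → ℝ) : Prop := v ≠ 0 ∧ pseudoMetric n v v = 0

/-- Causal means timelike or lightlike; the zero vector is not causal. -/
def IsCausalVec {n : ℕ} (v : Fin n → ℝ) : Prop := v ≠ 0 ∧ pseudoMetric n v v ≤ 0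

/-- A covector is causal if it is metrically dual to a causal vector. -/
def IsCausalCovec {n : ℕ} (α : Module.Dual ℝ (Fin n → ℝ)) : Prop :=
  ∃ v : Fin n → ℝ, pseudoMetric n v = α ∧ IsCausalVec v

/-- For every timelike `T` the covector `T ⌟ ω = ω(T, ·)` is causal. -/
def HasCausalContractions {n : ℕ} (ω : LinearMap.BilinForm ℝ (Fin n → ℝ)) : Prop :=
  ∀ T : Fin n → ℝ, IsTimelikeVec T → IsCausalCovec (ω T)

/-- The wedge product of two covectors: `(α ∧ β)(x, y) = α(x) β(y) - β(x) α(y)`. -/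
def wedgeCovec {n : ℕ} (α β : Module.Dual ℝ (Fin n → ℝ)) : LinearMap.BilinForm ℝ (Fin n → ℝ) :=
  α.smulRight β - β.smulRight α

/-- Restricted to the subspace `N`, the form `ω` is a nonzero multiple of a (pseudo-)Kähler form
`(x, y) ↦ g(J x, y)`, where `J` is an orthogonal complex structure on `N`. -/
def IsKaehlerMultipleOn {n : ℕ} (ω : LinearMap.BilinForm ℝ (Fin n → ℝ))
    (N : Submodule ℝ (Fin n → ℝ)) : Prop :=
  ∃ c : ℝ, c ≠ 0 ∧ ∃ J : N →ₗ[ℝ] N,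
    (∀ x : N, J (J x) = -x) ∧
    (∀ x y : N, pseudoMetric n (J x) (J y) = pseudoMetric n x y) ∧
    ∀ x y : N, ω x y = c * pseudoMetric n (J x) y

def IsTypeIa {n : ℕ} (ω : LinearMap.BilinForm ℝ (Fin n → ℝ)) : Prop :=
  ∃ l₁ l₂ : Fin n → ℝ, LinearIndependent ℝ ![l₁, l₂] ∧
    (∀ v ∈ Submodule.span ℝ {l₁, l₂}, pseudoMetric n v v = 0) ∧
    ω = wedgeCovec (pseudoMetric n l₁) (pseudoMetric n l₂)

def IsTypeIb {n : ℕ} (ω : LinearMap.BilinForm ℝ (Fin n → ℝ)) : Prop :=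
  ∃ l₁ t₁ : Fin n → ℝ, IsLightlikeVec l₁ ∧ IsTimelikeVec t₁ ∧ pseudoMetric n l₁ t₁ = 0 ∧
    ω = wedgeCovec (pseudoMetric n l₁) (pseudoMetric n t₁)

def IsTypeIIa {n : ℕ} (ω : LinearMap.BilinForm ℝ (Fin n → ℝ)) : Prop :=
  IsKaehlerMultipleOn ω ⊤

/-- `ω` is of Type (II_b) with Euclidean subspace `E`: `E` is nonzero and positive definite,
`ω` vanishes on `E` (that is, `x ⌟ ω = 0` for `x ∈ E`) and `ω` is a nonzero multiple of a
(pseudo-)Kähler form on the orthogonal complement of `E`. -/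
def IsTypeIIbWith {n : ℕ} (ω : LinearMap.BilinForm ℝ (Fin n → ℝ))
    (E : Submodule ℝ (Fin n → ℝ)) : Prop :=
  E ≠ ⊥ ∧ (∀ x ∈ E, x ≠ 0 → 0 < pseudoMetric n x x) ∧ (∀ x ∈ E, ω x = 0) ∧
    IsKaehlerMultipleOn ω ((pseudoMetric n).orthogonal E)

def IsTypeIIb {n : ℕ} (ω : LinearMap.BilinForm ℝ (Fin n → ℝ)) : Prop :=
  ∃ E : Submodule ℝ (Fin n → ℝ), IsTypeIIbWith ω E

/-- The linear automorphisms that leave the bilinear form `B` invariant. -/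
def formStabilizer {n : ℕ} (B : LinearMap.BilinForm ℝ (Fin n → ℝ)) :
    Subgroup ((Fin n → ℝ) ≃ₗ[ℝ] (Fin n → ℝ)) where
  carrier := {h | ∀ x y, B (h x) (h y) = B x y}
  mul_mem' := by
    intro a b ha hb x y
    exact (ha (b x) (b y)).trans (hb x y)
  one_mem' := by
    intro x y
    rfl
  inv_mem' := by
    intro a ha x y
    have h := ha (a⁻¹ x) (a⁻¹ y)
    rw [LinearEquiv.coe_inv, LinearEquiv.apply_symm_apply, LinearEquiv.apply_symm_apply] at h
    exact h.symm

/-- The pseudo-orthogonal group `O(2, n-2)`. -/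
noncomputable def pseudoO (n : ℕ) : Subgroup ((Fin n → ℝ) ≃ₗ[ℝ] (Fin n → ℝ)) :=
  formStabilizer (pseudoMetric n)

/-- The special pseudo-orthogonal group `SO(2, n-2)`: the elements of `O(2, n-2)` with
determinant one. -/
noncomputable def pseudoSO (n : ℕ) : Subgroup ((Fin n → ℝ) ≃ₗ[ℝ] (Fin n → ℝ)) :=
  pseudoO n ⊓ (LinearEquiv.det : ((Fin n → ℝ) ≃ₗ[ℝ] (Fin n → ℝ)) →* ℝˣ).ker

/-- The stabilizer of `ω` in `G` is maximal: no nonzero 2-form with causal contractions has a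
stabilizer in `G` that properly contains the one of `ω`. -/
def HasMaximalStabilizer {n : ℕ} (G : Subgroup ((Fin n → ℝ) ≃ₗ[ℝ] (Fin n → ℝ)))
    (ω : LinearMap.BilinForm ℝ (Fin n → ℝ)) : Prop :=
  ¬ ∃ η : LinearMap.BilinForm ℝ (Fin n → ℝ), η.IsAlt ∧ η ≠ 0 ∧ HasCausalContractions η ∧
    G ⊓ formStabilizer ω < G ⊓ formStabilizer η

/-! ### Geometry of signature (2, n-2): nonpositive subspaces and orthogonal complements. -/

open LinearMap (BilinForm)

/-! Write `ω = g(F ·, ·)` with `F = dualEndo ω` skew. An isometry stabilizes `ω` exactly when it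
commutes with `F`, so stabilizers are centralizers, and property 1 says that `F T` is nonzero and
nonspacelike for every timelike `T`. Throughout, index two is used in the form that a nonpositive
subspace has dimension at most 2.

Rigidity. For the listed types more than maximality holds: every 2-form `η` whose stabilizer
contains that of `ω` is a multiple of `ω`. For `l ∧ w` with `l` null and orthogonal to `w`, the
Eichler transvections along `l` lie in the stabilizer, and commuting with them forces `η = l ∧ z`; a
second null direction (I_a), or reflections in the kernel of `ω` (I_b), then determine `z` modulo
`l` up to a factor. For the Kähler types, the bireflections in `v` and `J v` force `F_η v` to be
parallel to `J v`, and reflections in `E` make `η` vanish on `E`. In SO single reflections must be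
replaced by products of two, which needs a second spacelike direction; this is the origin of the
exceptions `n = 4` and `dim E = 2`. There the stabilizer is contained in that of an explicit form of
Type (I_a) or (II_a), which by rigidity contradicts maximality.

Reduction. Property 1 and an S-lemma give an optimal `c ≥ 0` with `g(Fx, Fx) ≤ c g(x, x)` for all
`x`, with equality at some nonzero nonspacelike `k` (`exists_optimal_slope`). If `c = 0`, the image
of `F` is nonpositive, hence a plane, and `ω` is decomposable of Type (I). If `c > 0`, then `F² + c`
is semidefinite with nonzero kernel `K`, and `K` is invariant under the stabilizer. If `K` contains
a timelike vector, `F / √c` on `K`, extended by zero, is a partial complex structure; otherwise `k ∧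
F k` is of Type (I_a). In both cases the stabilizer of `ω` fixes the new form, so for maximal `ω`
rigidity makes `ω` a multiple of it. -/

theorem pseudoMetric_comm {n : ℕ} (x y : Fin n → ℝ) : pseudoMetric n x y = pseudoMetric n y x := by
  simp only [pseudoMetric_apply]
  exact Finset.sum_congr rfl fun i _ => by ring

theorem pseudoMetric_isRefl (n : ℕ) : (pseudoMetric n).IsRefl := fun x y h => by
  rw [pseudoMetric_comm, h]

theorem eq_zero_of_pseudoMetric {n : ℕ} {x : Fin n → ℝ} (h : ∀ y, pseudoMetric n x y = 0) :
    x = 0 := by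
  funext i
  have h1 := h (Pi.single i 1)
  rw [pseudoMetric_apply, Finset.sum_eq_single i] at h1
  · have h2 : pseudoSign i ≠ 0 := by unfold pseudoSign; split_ifs <;> norm_num
    simpa [h2] using h1
  · intro j _ hj
    simp [hj]
  · simp

theorem pseudoMetric_ext {n : ℕ} {x x' : Fin n → ℝ}
    (h : ∀ y, pseudoMetric n x y = pseudoMetric n x' y) : x = x' := by
  refine sub_eq_zero.1 (eq_zero_of_pseudoMetric fun y => ?_)
  rw [map_sub, LinearMap.sub_apply, h, sub_self]

theorem pseudoMetric_nondegenerate (n : ℕ) : (pseudoMetric n).Nondegenerate :=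
  ⟨fun _ h => eq_zero_of_pseudoMetric h,
    fun y h => eq_zero_of_pseudoMetric fun x => by rw [pseudoMetric_comm, h]⟩

/-- A subspace on which the metric is nonpositive has dimension at most two. -/
theorem finrank_le_two_of_nonpos {n : ℕ} (W : Submodule ℝ (Fin n → ℝ))
    (hW : ∀ x ∈ W, pseudoMetric n x x ≤ 0) : Module.finrank ℝ W ≤ 2 := by
  -- Projection to the two negative coordinates: on its kernel the metric is positive definite, so
  -- it is injective on `W`.
  let f : W →ₗ[ℝ] ({i : Fin n // i.val < 2} → ℝ) :=
    (LinearMap.funLeft ℝ ℝ (Subtype.val : {i : Fin n // i.val < 2} → Fin n)) ∘ₗ W.subtype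
  have hf : Function.Injective f := by
    rw [← LinearMap.ker_eq_bot, LinearMap.ker_eq_bot']
    rintro ⟨x, hx⟩ h
    have h0 : ∀ i : Fin n, i.val < 2 → x i = 0 := fun i hi => congrFun h ⟨i, hi⟩
    have h1 : ∀ i ∈ Finset.univ, 0 ≤ pseudoSign i * x i * x i := by
      intro i _
      by_cases hi : i.val < 2
      · simp [h0 i hi]
      · rw [pseudoSign, if_neg hi, one_mul]
        exact mul_self_nonneg _
    have h2 := hW x hx
    rw [pseudoMetric_apply] at h2
    have h3 := (Finset.sum_eq_zero_iff_of_nonneg h1).1 (le_antisymm h2 (Finset.sum_nonneg h1))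
    ext i
    by_cases hi : i.val < 2
    · exact h0 i hi
    · have := h3 i (Finset.mem_univ i)
      rw [pseudoSign, if_neg hi, one_mul] at this
      exact mul_self_eq_zero.1 this
  refine (LinearMap.finrank_le_finrank_of_injective hf).trans ?_
  rw [Module.finrank_fintype_fun_eq_card]
  have : Function.Injective (fun i : {i : Fin n // i.val < 2} => (⟨i.1.val, i.2⟩ : Fin 2)) := by
    rintro ⟨i, hi⟩ ⟨j, hj⟩ h
    simpa [Fin.ext_iff] using h
  simpa using Fintype.card_le_of_injective _ this

theorem exists_isTimelikeVec {n : ℕ} (hn : 2 ≤ n) : ∃ T : Fin n → ℝ, IsTimelikeVec T := by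
  refine ⟨Pi.single ⟨0, by omega⟩ 1, ?_⟩
  rw [IsTimelikeVec, pseudoMetric_apply, Finset.sum_eq_single ⟨0, by omega⟩]
  · simp [pseudoSign]
  · intro j _ hj
    simp [hj]
  · simp

theorem finrank_span_pair_of_linearIndependent {n : ℕ} {u v : Fin n → ℝ}
    (huv : LinearIndependent ℝ ![u, v]) : Module.finrank ℝ (Submodule.span ℝ {u, v}) = 2 := by
  have := finrank_span_eq_card huv
  rwa [Matrix.range_cons_cons_empty, Fintype.card_fin] at this

theorem linearIndependent_null_nonnull {n : ℕ} {l t : Fin n → ℝ} (hl : l ≠ 0)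
    (ht : pseudoMetric n t t ≠ 0) (hlt : pseudoMetric n l t = 0) :
    LinearIndependent ℝ ![l, t] := by
  rw [LinearIndependent.pair_iff]
  intro a b hab
  have h1 := congrArg (fun z => pseudoMetric n z t) hab
  simp only [map_add, LinearMap.add_apply, map_smul, LinearMap.smul_apply, smul_eq_mul, hlt,
    mul_zero, zero_add, map_zero, LinearMap.zero_apply, mul_eq_zero, ht, or_false] at h1
  rw [h1, zero_smul, add_zero] at hab
  exact ⟨(smul_eq_zero.1 hab).resolve_right hl, h1⟩

/-- A vector orthogonal to the orthogonal complement of a plane lies in the plane. -/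
theorem exists_eq_of_orthogonal_pair {n : ℕ} {u v w : Fin n → ℝ}
    (h : ∀ x, pseudoMetric n u x = 0 → pseudoMetric n v x = 0 → pseudoMetric n w x = 0) :
    ∃ a b : ℝ, a • u + b • v = w := by
  rw [← Submodule.mem_span_pair (R := ℝ), ← LinearMap.BilinForm.orthogonal_orthogonal
    (pseudoMetric_nondegenerate n) (pseudoMetric_isRefl n) (Submodule.span ℝ {u, v})]
  intro x hx
  rw [pseudoMetric_comm]
  exact h x (hx u (Submodule.subset_span (by simp))) (hx v (Submodule.subset_span (by simp)))

theorem exists_pseudoMetric_eq_one {n : ℕ} {l : Fin n → ℝ} (hl : l ≠ 0) :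
    ∃ x, pseudoMetric n l x = 1 := by
  by_contra! h
  refine hl (eq_zero_of_pseudoMetric fun x => ?_)
  by_contra hx
  exact h ((pseudoMetric n l x)⁻¹ • x) (by rw [map_smul, smul_eq_mul, inv_mul_cancel₀ hx])

theorem exists_pseudoMetric_eq_one_zero {n : ℕ} {u v : Fin n → ℝ}
    (huv : LinearIndependent ℝ ![u, v]) :
    ∃ x, pseudoMetric n u x = 1 ∧ pseudoMetric n v x = 0 := by
  by_contra! h
  -- If no such `x` exists, `u` is orthogonal to all of `v^⊥`, hence a multiple of `v`.
  obtain ⟨a, b, hab⟩ := exists_eq_of_orthogonal_pair (u := v) (v := v) (w := u) fun x hx _ => by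
    by_contra hu
    exact h ((pseudoMetric n u x)⁻¹ • x) (by rw [map_smul, smul_eq_mul, inv_mul_cancel₀ hu])
      (by rw [map_smul, hx, smul_zero])
  have := (LinearIndependent.pair_iff.1 huv 1 (-(a + b)) (by rw [← hab]; module)).1
  exact one_ne_zero this

/-- In a nonpositive plane's orthogonal complement, every nonspacelike vector lies in the plane. -/
theorem exists_eq_of_nonpos_plane {n : ℕ} {u v x : Fin n → ℝ} (huv : LinearIndependent ℝ ![u, v])
    (hneg : ∀ a b : ℝ, pseudoMetric n (a • u + b • v) (a • u + b • v) ≤ 0)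
    (hu : pseudoMetric n u x = 0) (hv : pseudoMetric n v x = 0) (hx : pseudoMetric n x x ≤ 0) :
    ∃ a b : ℝ, a • u + b • v = x := by
  rw [← Submodule.mem_span_pair (R := ℝ)]
  by_contra hmem
  have h2 := finrank_span_pair_of_linearIndependent huv
  have hlt : Submodule.span ℝ {u, v} < Submodule.span ℝ {u, v} ⊔ Submodule.span ℝ {x} := by
    refine lt_of_le_of_ne le_sup_left fun h => hmem ?_
    rw [h]
    exact Submodule.mem_sup_right (Submodule.mem_span_singleton_self x)
  have h3 := Submodule.finrank_lt_finrank_of_lt hlt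
  have h4 := finrank_le_two_of_nonpos (Submodule.span ℝ {u, v} ⊔ Submodule.span ℝ {x}) (by
    intro y hy
    obtain ⟨p, hp, q, hq, rfl⟩ := Submodule.mem_sup.1 hy
    obtain ⟨a, b, rfl⟩ := Submodule.mem_span_pair.1 hp
    obtain ⟨c, rfl⟩ := Submodule.mem_span_singleton.1 hq
    have h5 := hneg a b
    simp only [map_add, LinearMap.add_apply, map_smul, LinearMap.smul_apply, smul_eq_mul,
      pseudoMetric_comm x u, pseudoMetric_comm x v, hu, hv] at h5 ⊢
    nlinarith [mul_nonneg (mul_self_nonneg c) (neg_nonneg.2 hx)])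
  omega

/-! ### 2-forms as skew endomorphisms. -/

/-- The endomorphism dual to a bilinear form with respect to the metric. -/
noncomputable def dualEndo {n : ℕ} (ω : BilinForm ℝ (Fin n → ℝ)) : Module.End ℝ (Fin n → ℝ) :=
  ((pseudoMetric n).toDual (pseudoMetric_nondegenerate n)).symm.toLinearMap ∘ₗ ω

theorem pseudoMetric_dualEndo {n : ℕ} (ω : BilinForm ℝ (Fin n → ℝ)) (x y : Fin n → ℝ) :
    pseudoMetric n (dualEndo ω x) y = ω x y :=
  LinearMap.BilinForm.apply_toDual_symm_apply (hB := pseudoMetric_nondegenerate n) (ω x) y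

theorem dualEndo_skew {n : ℕ} {ω : BilinForm ℝ (Fin n → ℝ)} (hω : ω.IsAlt) (x y : Fin n → ℝ) :
    pseudoMetric n (dualEndo ω x) y = -pseudoMetric n x (dualEndo ω y) := by
  rw [pseudoMetric_comm x, pseudoMetric_dualEndo, pseudoMetric_dualEndo, hω.neg_eq]

theorem dualEndo_self {n : ℕ} {ω : BilinForm ℝ (Fin n → ℝ)} (hω : ω.IsAlt) (x : Fin n → ℝ) :
    pseudoMetric n (dualEndo ω x) x = 0 := by
  rw [pseudoMetric_dualEndo]
  exact hω x

theorem eq_dualEndo {n : ℕ} {ω : BilinForm ℝ (Fin n → ℝ)} {x z : Fin n → ℝ}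
    (h : ∀ y, ω x y = pseudoMetric n z y) : dualEndo ω x = z :=
  pseudoMetric_ext fun y => by rw [pseudoMetric_dualEndo, h]

/-- Turns stabilizers into centralizers; all later invariance arguments are commutation relations.
-/
theorem mem_formStabilizer_iff_dualEndo {n : ℕ} {ω : BilinForm ℝ (Fin n → ℝ)}
    {h : (Fin n → ℝ) ≃ₗ[ℝ] (Fin n → ℝ)} (hh : h ∈ pseudoO n) :
    h ∈ formStabilizer ω ↔ ∀ x, dualEndo ω (h x) = h (dualEndo ω x) := by
  constructor
  · intro hs x
    refine pseudoMetric_ext fun y => ?_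
    obtain ⟨z, rfl⟩ := h.surjective y
    rw [hh, pseudoMetric_dualEndo, pseudoMetric_dualEndo]
    exact hs x z
  · intro hs x y
    rw [← pseudoMetric_dualEndo, hs, hh, pseudoMetric_dualEndo]

theorem wedgeCovec_apply {n : ℕ} (α β : Module.Dual ℝ (Fin n → ℝ)) (x y : Fin n → ℝ) :
    wedgeCovec α β x y = α x * β y - β x * α y := by
  simp [wedgeCovec]

theorem dualEndo_wedge {n : ℕ} (u v x : Fin n → ℝ) :
    dualEndo (wedgeCovec (pseudoMetric n u) (pseudoMetric n v)) x =
      pseudoMetric n u x • v - pseudoMetric n v x • u :=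
  eq_dualEndo fun y => by simp [wedgeCovec_apply]

theorem wedgeCovec_isAlt {n : ℕ} (α β : Module.Dual ℝ (Fin n → ℝ)) : (wedgeCovec α β).IsAlt :=
  fun x => by rw [wedgeCovec_apply]; ring

theorem hasCausalContractions_of_dualEndo {n : ℕ} {ω : BilinForm ℝ (Fin n → ℝ)}
    (h : ∀ T : Fin n → ℝ, IsTimelikeVec T → dualEndo ω T ≠ 0 ∧
      pseudoMetric n (dualEndo ω T) (dualEndo ω T) ≤ 0) : HasCausalContractions ω := fun T hT =>
  ⟨dualEndo ω T, LinearMap.ext fun y => pseudoMetric_dualEndo ω T y, h T hT⟩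

theorem HasCausalContractions.dualEndo_nonpos {n : ℕ} {ω : BilinForm ℝ (Fin n → ℝ)}
    (h : HasCausalContractions ω) {T : Fin n → ℝ} (hT : IsTimelikeVec T) :
    pseudoMetric n (dualEndo ω T) (dualEndo ω T) ≤ 0 := by
  obtain ⟨v, hv, -, hv2⟩ := h T hT
  rwa [eq_dualEndo (z := v) fun y => by rw [hv]]

/-! ### Isometries as test elements: reflections and bireflections. -/

/-- A linear map preserving the metric, as a linear automorphism. -/
noncomputable def isometryEquiv {n : ℕ} (f : Module.End ℝ (Fin n → ℝ))
    (hf : ∀ x y, pseudoMetric n (f x) (f y) = pseudoMetric n x y) :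
    (Fin n → ℝ) ≃ₗ[ℝ] (Fin n → ℝ) :=
  LinearEquiv.ofInjectiveEndo f <| by
    rw [← LinearMap.ker_eq_bot, LinearMap.ker_eq_bot']
    intro x hx
    refine eq_zero_of_pseudoMetric fun y => ?_
    rw [← hf, hx, map_zero, LinearMap.zero_apply]

theorem isometryEquiv_mem_pseudoO {n : ℕ} (f : Module.End ℝ (Fin n → ℝ))
    (hf : ∀ x y, pseudoMetric n (f x) (f y) = pseudoMetric n x y) :
    isometryEquiv f hf ∈ pseudoO n := hf

theorem mem_pseudoSO_iff {n : ℕ} {h : (Fin n → ℝ) ≃ₗ[ℝ] (Fin n → ℝ)} :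
    h ∈ pseudoSO n ↔ h ∈ pseudoO n ∧ LinearMap.det (h : Module.End ℝ (Fin n → ℝ)) = 1 := by
  rw [pseudoSO, Subgroup.mem_inf, MonoidHom.mem_ker, Units.ext_iff, LinearEquiv.coe_det,
    Units.val_one]

theorem isometryEquiv_mem_pseudoSO {n : ℕ} (f : Module.End ℝ (Fin n → ℝ))
    (hf : ∀ x y, pseudoMetric n (f x) (f y) = pseudoMetric n x y) (hdet : LinearMap.det f = 1) :
    isometryEquiv f hf ∈ pseudoSO n :=
  mem_pseudoSO_iff.2 ⟨hf, hdet⟩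

theorem det_mul_self_of_isometry {n : ℕ} (f : Module.End ℝ (Fin n → ℝ))
    (hf : ∀ x y, pseudoMetric n (f x) (f y) = pseudoMetric n x y) :
    LinearMap.det f * LinearMap.det f = 1 := by
  have h1 : (pseudoMetric n).comp f f = pseudoMetric n := LinearMap.ext₂ hf
  have h2 := congrArg (fun B => (LinearMap.BilinForm.toMatrix' B).det) h1
  simp only [LinearMap.BilinForm.toMatrix'_comp, Matrix.det_mul, Matrix.det_transpose,
    LinearMap.det_toMatrix'] at h2
  have h3 : (LinearMap.BilinForm.toMatrix' (pseudoMetric n)).det ≠ 0 := by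
    rw [pseudoMetric, LinearMap.BilinForm.toMatrix'_toBilin', Matrix.det_diagonal]
    refine Finset.prod_ne_zero_iff.2 fun i _ => ?_
    unfold pseudoSign
    split_ifs <;> norm_num
  exact mul_right_cancel₀ h3 (by linear_combination h2)

/-- The bireflection in two orthogonal vectors. -/
noncomputable def bireflection {n : ℕ} (v w : Fin n → ℝ) : Module.End ℝ (Fin n → ℝ) :=
  LinearMap.transvection (-(2 / pseudoMetric n v v) • pseudoMetric n v) v *
    LinearMap.transvection (-(2 / pseudoMetric n w w) • pseudoMetric n w) w

theorem transvection_isometry {n : ℕ} {v : Fin n → ℝ} (hv : pseudoMetric n v v ≠ 0)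
    (x y : Fin n → ℝ) :
    pseudoMetric n (LinearMap.transvection (-(2 / pseudoMetric n v v) • pseudoMetric n v) v x)
      (LinearMap.transvection (-(2 / pseudoMetric n v v) • pseudoMetric n v) v y) =
      pseudoMetric n x y := by
  simp only [LinearMap.transvection.apply, map_add, LinearMap.add_apply, map_smul,
    LinearMap.smul_apply, smul_eq_mul, pseudoMetric_comm x v]
  field_simp
  ring

theorem det_bireflection {n : ℕ} {v w : Fin n → ℝ} (hv : pseudoMetric n v v ≠ 0)
    (hw : pseudoMetric n w w ≠ 0) : LinearMap.det (bireflection v w) = 1 := by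
  rw [bireflection, map_mul, LinearMap.transvection.det, LinearMap.transvection.det]
  simp only [LinearMap.smul_apply, smul_eq_mul]
  field_simp
  norm_num

theorem bireflection_isometry {n : ℕ} {v w : Fin n → ℝ} (hv : pseudoMetric n v v ≠ 0)
    (hw : pseudoMetric n w w ≠ 0) (x y : Fin n → ℝ) :
    pseudoMetric n (bireflection v w x) (bireflection v w y) = pseudoMetric n x y := by
  rw [bireflection, Module.End.mul_apply, Module.End.mul_apply, transvection_isometry hv,
    transvection_isometry hw]

theorem bireflection_apply {n : ℕ} {v w : Fin n → ℝ} (hvw : pseudoMetric n v w = 0)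
    (x : Fin n → ℝ) : bireflection v w x =
      x - (2 / pseudoMetric n v v * pseudoMetric n v x) • v -
        (2 / pseudoMetric n w w * pseudoMetric n w x) • w := by
  simp only [bireflection, Module.End.mul_apply, LinearMap.transvection.apply,
    LinearMap.smul_apply, smul_eq_mul, map_add, map_smul, hvw]
  module

theorem dualEndo_commute_of_le {n : ℕ} {G : Subgroup ((Fin n → ℝ) ≃ₗ[ℝ] (Fin n → ℝ))}
    (hG : G ≤ pseudoO n) {ω η : BilinForm ℝ (Fin n → ℝ)}
    (hle : G ⊓ formStabilizer ω ≤ G ⊓ formStabilizer η) {f : Module.End ℝ (Fin n → ℝ)}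
    (hf : ∀ x y, pseudoMetric n (f x) (f y) = pseudoMetric n x y) (hfG : isometryEquiv f hf ∈ G)
    (hc : ∀ x, dualEndo ω (f x) = f (dualEndo ω x)) (x : Fin n → ℝ) :
    dualEndo η (f x) = f (dualEndo η x) :=
  (mem_formStabilizer_iff_dualEndo (hG hfG)).1
    (hle ⟨hfG, (mem_formStabilizer_iff_dualEndo (hG hfG)).2 hc⟩).2 x

/-- Invariance under the reflections stabilizing `ω` forces `η` to vanish on the nonnull kernel
vectors of `ω`. -/
theorem dualEndo_eq_zero_of_le {n : ℕ} {ω η : BilinForm ℝ (Fin n → ℝ)} (hω : ω.IsAlt)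
    (hη : η.IsAlt) (hle : pseudoO n ⊓ formStabilizer ω ≤ pseudoO n ⊓ formStabilizer η)
    {v : Fin n → ℝ} (hv : pseudoMetric n v v ≠ 0) (hωv : dualEndo ω v = 0) :
    dualEndo η v = 0 := by
  -- The reflection in `v` negates `v` and fixes `dualEndo η v`, which is orthogonal to `v`;
  -- commutation therefore gives `dualEndo η v = -dualEndo η v`.
  have hc := dualEndo_commute_of_le le_rfl hle (transvection_isometry hv)
    (isometryEquiv_mem_pseudoO _ _) (fun x => by
      have h1 := dualEndo_skew hω v x
      simp only [hωv, map_zero, LinearMap.zero_apply] at h1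
      simp only [LinearMap.transvection.apply, map_add, map_smul, hωv, LinearMap.smul_apply,
        smul_eq_mul, smul_zero, add_zero]
      rw [neg_eq_zero.1 h1.symm, mul_zero, zero_smul, add_zero]) v
  have h2 := dualEndo_self hη v
  rw [pseudoMetric_comm] at h2
  simp only [LinearMap.transvection.apply, map_add, map_smul, LinearMap.smul_apply, smul_eq_mul,
    h2, mul_zero, zero_smul, add_zero] at hc
  have h3 : -(2 / pseudoMetric n v v) * pseudoMetric n v v = -2 := by field_simp
  rw [h3] at hc
  linear_combination (norm := module) (-1 / 2 : ℝ) • hc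

/-- Invariance under a bireflection stabilizing `ω` constrains `η`. -/
theorem exists_dualEndo_eq_smul_of_le {n : ℕ} {G : Subgroup ((Fin n → ℝ) ≃ₗ[ℝ] (Fin n → ℝ))}
    (hG : G ≤ pseudoO n) (hG' : pseudoSO n ≤ G) {ω η : BilinForm ℝ (Fin n → ℝ)} (hω : ω.IsAlt)
    (hη : η.IsAlt) (hle : G ⊓ formStabilizer ω ≤ G ⊓ formStabilizer η) {v w : Fin n → ℝ}
    (hv : pseudoMetric n v v ≠ 0) (hw : pseudoMetric n w w ≠ 0) (hvw : pseudoMetric n v w = 0)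
    {a b : ℝ} (hωv : dualEndo ω v = a • w) (hωw : dualEndo ω w = b • v) :
    ∃ α : ℝ, dualEndo η v = α • w := by
  -- The bireflection commutes with the skew map `dualEndo ω` because that map preserves the span of
  -- `v` and `w`. At `v`, where the bireflection is -1, commutation puts `dualEndo η v` in this
  -- span, and skewness removes the `v` component.
  have hc := dualEndo_commute_of_le hG hle (bireflection_isometry hv hw)
    (hG' (isometryEquiv_mem_pseudoSO _ _ (det_bireflection hv hw))) (fun x => by
      have h1 := dualEndo_skew hω v x
      have h2 := dualEndo_skew hω w x
      have h3 := dualEndo_skew hω v w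
      simp only [hωv, hωw, map_smul, LinearMap.smul_apply, smul_eq_mul] at h1 h2 h3
      rw [bireflection_apply hvw, bireflection_apply hvw]
      simp only [map_sub, map_smul, hωv, hωw]
      rw [show pseudoMetric n v (dualEndo ω x) = -(a * pseudoMetric n w x) by linarith,
        show pseudoMetric n w (dualEndo ω x) = -(b * pseudoMetric n v x) by linarith]
      match_scalars
      · ring
      · field_simp
        linear_combination -pseudoMetric n v x * h3
      · field_simp
        linear_combination -pseudoMetric n w x * h3) v
  have h4 := dualEndo_self hη v
  rw [pseudoMetric_comm] at h4
  rw [bireflection_apply hvw, bireflection_apply hvw, h4, pseudoMetric_comm w v, hvw] at hc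
  simp only [mul_zero, zero_smul, sub_zero, map_sub, map_smul] at hc
  rw [div_mul_cancel₀ _ hv] at hc
  refine ⟨pseudoMetric n w (dualEndo η v) / pseudoMetric n w w, ?_⟩
  linear_combination (norm := module) (-1 / 2 : ℝ) • hc

/-! ### Eichler transvections and the forms they fix. -/

/-- The infinitesimal generator `x ↦ g(l, x) u - g(u, x) l` of the Eichler transvections. -/
noncomputable def eichlerGen {n : ℕ} (l u : Fin n → ℝ) : Module.End ℝ (Fin n → ℝ) :=
  (pseudoMetric n l).smulRight u - (pseudoMetric n u).smulRight l

theorem eichlerGen_apply {n : ℕ} (l u x : Fin n → ℝ) :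
    eichlerGen l u x = pseudoMetric n l x • u - pseudoMetric n u x • l := by
  simp [eichlerGen]

theorem eichlerGen_smul {n : ℕ} (c : ℝ) (l u : Fin n → ℝ) :
    eichlerGen l (c • u) = c • eichlerGen l u := by
  refine LinearMap.ext fun x => ?_
  simp only [eichlerGen_apply, map_smul, LinearMap.smul_apply, smul_eq_mul]
  module

/-- The Eichler transvection along a null vector `l` and a vector `u` orthogonal to it. -/
noncomputable def eichler {n : ℕ} (l u : Fin n → ℝ) : Module.End ℝ (Fin n → ℝ) :=
  1 + eichlerGen l u + (1 / 2 : ℝ) • (eichlerGen l u * eichlerGen l u)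

theorem eichler_apply {n : ℕ} {l u : Fin n → ℝ} (hl : pseudoMetric n l l = 0)
    (hlu : pseudoMetric n l u = 0) (x : Fin n → ℝ) : eichler l u x =
      x + pseudoMetric n l x • u - pseudoMetric n u x • l -
        (1 / 2 * pseudoMetric n u u * pseudoMetric n l x) • l := by
  simp only [eichler, LinearMap.add_apply, Module.End.one_apply, LinearMap.smul_apply,
    Module.End.mul_apply, eichlerGen_apply, map_sub, map_smul, hl, hlu,
    pseudoMetric_comm u l]
  module

theorem eichler_isometry {n : ℕ} {l u : Fin n → ℝ} (hl : pseudoMetric n l l = 0)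
    (hlu : pseudoMetric n l u = 0) (x y : Fin n → ℝ) :
    pseudoMetric n (eichler l u x) (eichler l u y) = pseudoMetric n x y := by
  simp only [eichler_apply hl hlu, map_sub, map_add, map_smul, LinearMap.sub_apply,
    LinearMap.add_apply, LinearMap.smul_apply, smul_eq_mul, hl, hlu, pseudoMetric_comm u l,
    pseudoMetric_comm x l, pseudoMetric_comm x u]
  ring

theorem eichler_half_mul_self {n : ℕ} {l u : Fin n → ℝ} (hl : pseudoMetric n l l = 0)
    (hlu : pseudoMetric n l u = 0) :
    eichler l ((1 / 2 : ℝ) • u) * eichler l ((1 / 2 : ℝ) • u) = eichler l u := by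
  have hlu' : pseudoMetric n l ((1 / 2 : ℝ) • u) = 0 := by rw [map_smul, hlu, smul_zero]
  refine LinearMap.ext fun x => ?_
  rw [Module.End.mul_apply]
  simp only [eichler_apply hl hlu, eichler_apply hl hlu', map_sub, map_add, map_smul,
    LinearMap.smul_apply, smul_eq_mul, hl, hlu, pseudoMetric_comm u l]
  module

/-- The transvection is the square of the isometry with `u` halved, and isometries have determinant
±1. -/
theorem det_eichler {n : ℕ} {l u : Fin n → ℝ} (hl : pseudoMetric n l l = 0)
    (hlu : pseudoMetric n l u = 0) : LinearMap.det (eichler l u) = 1 := by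
  rw [← eichler_half_mul_self hl hlu, map_mul]
  exact det_mul_self_of_isometry _
    (eichler_isometry hl (by rw [map_smul, hlu, smul_zero]))

/-- Passes from the group to the generator: the transvection is the polynomial `1 + N + N²/2` in its
generator `N`, and conversely `N` is half the difference of the transvections along `u` and `-u`. -/
theorem commute_eichlerGen_of_le {n : ℕ} {G : Subgroup ((Fin n → ℝ) ≃ₗ[ℝ] (Fin n → ℝ))}
    (hG : G ≤ pseudoO n) (hG' : pseudoSO n ≤ G) {ω η : BilinForm ℝ (Fin n → ℝ)}
    (hle : G ⊓ formStabilizer ω ≤ G ⊓ formStabilizer η) {l u : Fin n → ℝ}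
    (hl : pseudoMetric n l l = 0) (hlu : pseudoMetric n l u = 0)
    (hc : Commute (dualEndo ω) (eichlerGen l u)) : Commute (dualEndo η) (eichlerGen l u) := by
  have key : ∀ v, pseudoMetric n l v = 0 → Commute (dualEndo ω) (eichlerGen l v) →
      Commute (dualEndo η) (eichler l v) := by
    intro v hlv hcv
    have h1 : Commute (dualEndo ω) (eichler l v) :=
      ((Commute.one_right _).add_right hcv).add_right ((hcv.mul_right hcv).smul_right _)
    exact LinearMap.ext (dualEndo_commute_of_le hG hle (eichler_isometry hl hlv)
      (hG' (isometryEquiv_mem_pseudoSO _ _ (det_eichler hl hlv))) (LinearMap.congr_fun h1))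
  have h2 := key u hlu hc
  have h3 := key ((-1 : ℝ) • u) (by rw [map_smul, hlu, smul_zero])
    (by rw [eichlerGen_smul]; exact hc.smul_right _)
  have h4 : eichlerGen l u = (1 / 2 : ℝ) • (eichler l u - eichler l ((-1 : ℝ) • u)) := by
    simp only [eichler, eichlerGen_smul, smul_mul_assoc, mul_smul_comm]
    module
  rw [h4]
  exact (h2.sub_right h3).smul_right _

/-- Every term of the bracket of `l ∧ w` and `l ∧ u` contains `g(l,l)`, `g(l,w)`, `g(l,u)` or `l ∧
l`. -/
theorem commute_dualEndo_wedge_eichlerGen {n : ℕ} {l w u : Fin n → ℝ}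
    (hl : pseudoMetric n l l = 0) (hlw : pseudoMetric n l w = 0) (hlu : pseudoMetric n l u = 0) :
    Commute (dualEndo (wedgeCovec (pseudoMetric n l) (pseudoMetric n w))) (eichlerGen l u) := by
  refine LinearMap.ext fun x => ?_
  simp only [Module.End.mul_apply, dualEndo_wedge, eichlerGen_apply, map_sub, map_smul, hl, hlw,
    hlu, pseudoMetric_comm w l, pseudoMetric_comm u l, pseudoMetric_comm w u]
  module

/-- Computes the centralizer of `l ∧ l^⊥` among skew maps. The nonnull `v` in `l^⊥` forces `F l =
0`; then `F` maps `l^⊥` into the line of `l`, and `F = l ∧ F z` for any `z` with `g(l, z) = 1`. -/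
theorem dualEndo_eq_of_commute_eichlerGen {n : ℕ} {η : BilinForm ℝ (Fin n → ℝ)} (hη : η.IsAlt)
    {l v : Fin n → ℝ} (hl : l ≠ 0) (hll : pseudoMetric n l l = 0)
    (hlv : pseudoMetric n l v = 0) (hv : pseudoMetric n v v ≠ 0)
    (hc : ∀ u, pseudoMetric n l u = 0 → Commute (dualEndo η) (eichlerGen l u)) :
    ∃ w, pseudoMetric n l w = 0 ∧
      ∀ y, dualEndo η y = pseudoMetric n l y • w - pseudoMetric n w y • l := by
  -- This is `F l ∧ u + l ∧ F u = 0`, the bracket of `F` with `l ∧ u` rewritten by skewness.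
  have key : ∀ u, pseudoMetric n l u = 0 → ∀ x,
      pseudoMetric n l x • dualEndo η u - pseudoMetric n u x • dualEndo η l =
        pseudoMetric n (dualEndo η u) x • l - pseudoMetric n (dualEndo η l) x • u := by
    intro u hu x
    have h1 := LinearMap.congr_fun (hc u hu) x
    simp only [Module.End.mul_apply, eichlerGen_apply, map_sub, map_smul] at h1
    rw [h1, dualEndo_skew hη u, dualEndo_skew hη l]
    module
  obtain ⟨z, hz⟩ := exists_pseudoMetric_eq_one hl
  have h1 := key v hlv v
  rw [hlv, dualEndo_self hη, zero_smul, zero_smul, zero_sub, zero_sub, neg_inj] at h1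
  have h2 : dualEndo η l =
      (pseudoMetric n (dualEndo η l) v / pseudoMetric n v v) • v := by
    rw [div_eq_inv_mul, mul_smul, ← h1, smul_smul, inv_mul_cancel₀ hv, one_smul]
  have h3 : dualEndo η l = 0 := by
    have h4 := key v hlv z
    have h5 : dualEndo η v = pseudoMetric n (dualEndo η v) z • l := by
      set β := pseudoMetric n (dualEndo η l) v / pseudoMetric n v v
      rw [h2, hz, one_smul, map_smul, LinearMap.smul_apply, smul_eq_mul] at h4
      linear_combination (norm := module) h4
    have h6 : pseudoMetric n (dualEndo η l) v = 0 := by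
      rw [dualEndo_skew hη, h5, map_smul, hll, smul_zero, neg_zero]
    rw [h2, h6, zero_div, zero_smul]
  refine ⟨dualEndo η z, ?_, fun y => ?_⟩
  · rw [pseudoMetric_comm, dualEndo_skew hη, h3, map_zero, neg_zero]
  · have hu : pseudoMetric n l (y - pseudoMetric n l y • z) = 0 := by
      rw [map_sub, map_smul, hz, smul_eq_mul, mul_one, sub_self]
    have h4 := key _ hu z
    rw [h3, hz, map_zero, LinearMap.zero_apply, zero_smul, smul_zero, one_smul, sub_zero,
      sub_zero, dualEndo_skew hη, map_sub, map_smul, map_sub, map_smul, LinearMap.sub_apply,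
      LinearMap.smul_apply, pseudoMetric_comm z, dualEndo_self hη, smul_zero, sub_zero,
      pseudoMetric_comm y] at h4
    linear_combination (norm := module) h4

theorem eq_smul_of_dualEndo {n : ℕ} {ω η : BilinForm ℝ (Fin n → ℝ)} {c : ℝ}
    (h : ∀ x, dualEndo η x = c • dualEndo ω x) : η = c • ω :=
  LinearMap.ext₂ fun x y => by
    rw [← pseudoMetric_dualEndo, h, map_smul, LinearMap.smul_apply, pseudoMetric_dualEndo,
      LinearMap.smul_apply, LinearMap.smul_apply]

/-! ### Rigidity of Types (I_a) and (I_b). -/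

/-- For a totally null plane, the inner products of its spanning vectors vanish. -/
theorem null_plane_products {n : ℕ} {l₁ l₂ : Fin n → ℝ}
    (h : ∀ v ∈ Submodule.span ℝ {l₁, l₂}, pseudoMetric n v v = 0) :
    pseudoMetric n l₁ l₁ = 0 ∧ pseudoMetric n l₂ l₂ = 0 ∧ pseudoMetric n l₁ l₂ = 0 := by
  have h1 := h l₁ (Submodule.subset_span (by simp))
  have h2 := h l₂ (Submodule.subset_span (by simp))
  have h3 := h (l₁ + l₂)
    (add_mem (Submodule.subset_span (by simp)) (Submodule.subset_span (by simp)))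
  simp only [map_add, LinearMap.add_apply, h1, h2, pseudoMetric_comm l₂ l₁] at h3
  exact ⟨h1, h2, by linarith⟩

theorem dualEndo_eq_of_le_wedge {n : ℕ} {G : Subgroup ((Fin n → ℝ) ≃ₗ[ℝ] (Fin n → ℝ))}
    (hG : G ≤ pseudoO n) (hG' : pseudoSO n ≤ G) {η : BilinForm ℝ (Fin n → ℝ)} (hη : η.IsAlt)
    {l w v : Fin n → ℝ} (hl : l ≠ 0) (hll : pseudoMetric n l l = 0) (hlw : pseudoMetric n l w = 0)
    (hle : G ⊓ formStabilizer (wedgeCovec (pseudoMetric n l) (pseudoMetric n w)) ≤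
      G ⊓ formStabilizer η) (hlv : pseudoMetric n l v = 0) (hv : pseudoMetric n v v ≠ 0) :
    ∃ z, pseudoMetric n l z = 0 ∧
      ∀ y, dualEndo η y = pseudoMetric n l y • z - pseudoMetric n z y • l :=
  dualEndo_eq_of_commute_eichlerGen hη hl hll hlv hv fun _ hu =>
    commute_eichlerGen_of_le hG hG' hle hll hu (commute_dualEndo_wedge_eichlerGen hll hlw hu)

theorem exists_nonnull_orthogonal {n : ℕ} {l₁ l₂ : Fin n → ℝ}
    (hli : LinearIndependent ℝ ![l₁, l₂]) (h12 : pseudoMetric n l₁ l₂ = 0)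
    (h22 : pseudoMetric n l₂ l₂ = 0) :
    ∃ v, pseudoMetric n l₁ v = 0 ∧ pseudoMetric n v v ≠ 0 := by
  obtain ⟨y, hy1, hy2⟩ := exists_pseudoMetric_eq_one_zero (LinearIndependent.pair_symm_iff.1 hli)
  by_cases hy : pseudoMetric n y y = 0
  -- If `y` is null, then `g(y + l₂, y + l₂) = 2 g(l₂, y) = 2`.
  · refine ⟨y + l₂, by rw [map_add, hy2, h12, add_zero], ?_⟩
    simp only [map_add, LinearMap.add_apply, hy, h22, hy1, pseudoMetric_comm y l₂]
    norm_num
  · exact ⟨y, hy2, hy⟩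

/-- Transvections along both null vectors are available, so `η = l₁ ∧ w₁ = l₂ ∧ w₂`; comparing the
two puts `w₁` in the null plane. -/
theorem IsTypeIa.eq_smul_of_le {n : ℕ} {G : Subgroup ((Fin n → ℝ) ≃ₗ[ℝ] (Fin n → ℝ))}
    (hG : G ≤ pseudoO n) (hG' : pseudoSO n ≤ G) {ω η : BilinForm ℝ (Fin n → ℝ)}
    (hω : IsTypeIa ω) (hη : η.IsAlt) (hle : G ⊓ formStabilizer ω ≤ G ⊓ formStabilizer η) :
    ∃ c : ℝ, η = c • ω := by
  obtain ⟨l₁, l₂, hli, hnull, rfl⟩ := hω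
  obtain ⟨h11, h22, h12⟩ := null_plane_products hnull
  have h21 : pseudoMetric n l₂ l₁ = 0 := by rw [pseudoMetric_comm, h12]
  have hli' := LinearIndependent.pair_symm_iff.1 hli
  have hl₁ : l₁ ≠ 0 := hli.ne_zero 0
  have hl₂ : l₂ ≠ 0 := hli.ne_zero 1
  obtain ⟨v₁, hv₁, hv₁'⟩ := exists_nonnull_orthogonal hli h12 h22
  obtain ⟨v₂, hv₂, hv₂'⟩ := exists_nonnull_orthogonal hli' h21 h11
  have hswap : formStabilizer (wedgeCovec (pseudoMetric n l₁) (pseudoMetric n l₂)) =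
      formStabilizer (wedgeCovec (pseudoMetric n l₂) (pseudoMetric n l₁)) := by
    ext h
    change (∀ x y, _) ↔ (∀ x y, _)
    simp only [wedgeCovec_apply]
    constructor <;> intro H x y <;> linarith [H x y]
  obtain ⟨w₁, hw₁, hF₁⟩ := dualEndo_eq_of_le_wedge hG hG' hη hl₁ h11 h12 hle hv₁ hv₁'
  rw [hswap] at hle
  obtain ⟨w₂, hw₂, hF₂⟩ := dualEndo_eq_of_le_wedge hG hG' hη hl₂ h22 h21 hle hv₂ hv₂'
  obtain ⟨y, hy1, hy2⟩ := exists_pseudoMetric_eq_one_zero hli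
  have h1 := hF₁ y
  rw [hF₂ y, hy1, hy2, zero_smul, one_smul, zero_sub] at h1
  refine ⟨-pseudoMetric n w₂ y, eq_smul_of_dualEndo fun x => ?_⟩
  have h2 : w₁ = pseudoMetric n w₁ y • l₁ - pseudoMetric n w₂ y • l₂ := by
    linear_combination (norm := module) -h1
  generalize pseudoMetric n w₁ y = a at h2
  rw [hF₁, dualEndo_wedge, h2]
  simp only [map_sub, map_smul, LinearMap.sub_apply, LinearMap.smul_apply, smul_eq_mul]
  module

theorem lightlike_timelike_nonpos {n : ℕ} {l t : Fin n → ℝ} (hl : IsLightlikeVec l)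
    (ht : IsTimelikeVec t) (hlt : pseudoMetric n l t = 0) (a b : ℝ) :
    pseudoMetric n (a • l + b • t) (a • l + b • t) ≤ 0 := by
  simp only [map_add, map_smul, LinearMap.add_apply, LinearMap.smul_apply, smul_eq_mul, hl.2,
    pseudoMetric_comm t l, hlt]
  nlinarith [mul_nonneg (mul_self_nonneg b) (neg_nonneg.2 ht.le)]

/-- Orthogonally to a null vector and a timelike vector, all vectors outside the null line are
spacelike. -/
theorem pos_of_orthogonal {n : ℕ} {l t s : Fin n → ℝ} (hl : IsLightlikeVec l)
    (ht : IsTimelikeVec t) (hlt : pseudoMetric n l t = 0) (hls : pseudoMetric n l s = 0)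
    (hts : pseudoMetric n t s = 0) (hs : s ∉ Submodule.span ℝ {l}) : 0 < pseudoMetric n s s := by
  have ht' : pseudoMetric n t t ≠ 0 := ne_of_lt ht
  by_contra! hneg
  obtain ⟨a, b, rfl⟩ := exists_eq_of_nonpos_plane (linearIndependent_null_nonnull hl.1 ht' hlt)
    (lightlike_timelike_nonpos hl ht hlt) hls hts hneg
  simp only [map_add, map_smul, smul_eq_mul, pseudoMetric_comm t l, hlt, mul_zero, zero_add,
    mul_eq_zero, ht', or_false] at hts
  rw [hts, zero_smul, add_zero] at hs
  exact hs (Submodule.smul_mem _ _ (Submodule.mem_span_singleton_self l))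

/-- Given a null vector and a timelike vector orthogonal to it, a spacelike vector orthogonal to
both can be completed by another one if the dimension is not four. -/
theorem exists_spacelike_orthogonal {n : ℕ} (hn : n ≠ 4) {l t s : Fin n → ℝ} (hl : IsLightlikeVec l)
    (ht : IsTimelikeVec t) (hlt : pseudoMetric n l t = 0) (hls : pseudoMetric n l s = 0)
    (hts : pseudoMetric n t s = 0) (hs : 0 < pseudoMetric n s s) :
    ∃ s', pseudoMetric n l s' = 0 ∧ pseudoMetric n t s' = 0 ∧ pseudoMetric n s s' = 0 ∧
      0 < pseudoMetric n s' s' := by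
  have hlt' := linearIndependent_null_nonnull hl.1 (ne_of_lt ht) hlt
  have hdim := LinearMap.BilinForm.finrank_orthogonal (pseudoMetric_nondegenerate n)
  -- The independent vectors `l`, `s` lie in `{l, t}^⊥`, of dimension `n - 2`. With `n ≠ 4` this
  -- gives `n ≥ 5`, so `{l, t, s}^⊥` is larger than the line of `l`.
  have h4 : 4 ≤ n := by
    have h1 : Submodule.span ℝ {l, s} ≤
        (pseudoMetric n).orthogonal (Submodule.span ℝ {l, t}) := by
      rw [Submodule.span_le]
      intro x hx y hy
      obtain ⟨a, b, rfl⟩ := Submodule.mem_span_pair.1 hy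
      obtain rfl | rfl := hx
      · simp [LinearMap.add_apply, hl.2, pseudoMetric_comm t, hlt]
      · simp [LinearMap.add_apply, hls, hts]
    have h2 := Submodule.finrank_mono h1
    rw [finrank_span_pair_of_linearIndependent
      (linearIndependent_null_nonnull hl.1 hs.ne' hls), hdim,
      finrank_span_pair_of_linearIndependent hlt', Module.finrank_fin_fun] at h2
    omega
  have h5 : 2 ≤ Module.finrank ℝ ((pseudoMetric n).orthogonal (Submodule.span ℝ {l, t, s})) := by
    rw [hdim, Module.finrank_fin_fun]
    have h6 : Module.finrank ℝ (Submodule.span ℝ {l, t, s}) ≤ 3 := by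
      have := finrank_range_le_card (R := ℝ) ![l, t, s]
      rwa [Matrix.range_cons, Matrix.range_cons_cons_empty, Set.singleton_union] at this
    omega
  obtain ⟨s', hs', hs'l⟩ := SetLike.not_le_iff_exists.1
    (show ¬ (pseudoMetric n).orthogonal (Submodule.span ℝ {l, t, s}) ≤ Submodule.span ℝ {l} from
      fun h => by
        have h8 := Submodule.finrank_mono h
        have h9 := finrank_span_singleton (K := ℝ) hl.1
        omega)
  have ho : ∀ z ∈ ({l, t, s} : Set (Fin n → ℝ)), pseudoMetric n z s' = 0 := fun z hz =>
    hs' z (Submodule.subset_span hz)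
  have hl' := ho l (by simp)
  have ht' := ho t (by simp)
  refine ⟨s', hl', ht', ho s (by simp), ?_⟩
  exact pos_of_orthogonal hl ht hlt hl' ht' hs'l

/-- Transvections along `l` give `η = l ∧ w`. A vector orthogonal to `l` and `t` is a multiple of
`l` or spacelike; in the second case a reflection, or in SO a bireflection with another such vector,
shows that it is orthogonal to `w`. Hence `w` lies in the span of `l` and `t`. -/
theorem IsTypeIb.eq_smul_of_le {n : ℕ} {G : Subgroup ((Fin n → ℝ) ≃ₗ[ℝ] (Fin n → ℝ))}
    (hG : G = pseudoO n ∨ G = pseudoSO n ∧ n ≠ 4) {ω η : BilinForm ℝ (Fin n → ℝ)}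
    (hω : IsTypeIb ω) (hη : η.IsAlt) (hle : G ⊓ formStabilizer ω ≤ G ⊓ formStabilizer η) :
    ∃ c : ℝ, η = c • ω := by
  have hGO : G ≤ pseudoO n := by
    obtain rfl | ⟨rfl, -⟩ := hG
    exacts [le_rfl, inf_le_left]
  have hGSO : pseudoSO n ≤ G := by
    obtain rfl | ⟨rfl, -⟩ := hG
    exacts [inf_le_left, le_rfl]
  obtain ⟨l, t, hl, ht, hlt, rfl⟩ := hω
  have ht' : pseudoMetric n t t ≠ 0 := ne_of_lt ht
  obtain ⟨w, hw, hF⟩ := dualEndo_eq_of_le_wedge hGO hGSO hη hl.1 hl.2 hlt hle hlt ht'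
  have hzero : ∀ x, pseudoMetric n l x = 0 → dualEndo η x = 0 → pseudoMetric n w x = 0 := by
    intro x hx hx0
    rw [hF, hx, zero_smul, zero_sub, neg_eq_zero] at hx0
    exact (smul_eq_zero.1 hx0).resolve_right hl.1
  obtain ⟨a, b, rfl⟩ := exists_eq_of_orthogonal_pair (u := l) (v := t) (w := w) fun x hlx htx => by
    have hωx : dualEndo (wedgeCovec (pseudoMetric n l) (pseudoMetric n t)) x = 0 := by
      rw [dualEndo_wedge, hlx, htx, zero_smul, zero_smul, sub_zero]
    by_cases hxl : x ∈ Submodule.span ℝ {l}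
    · obtain ⟨a, rfl⟩ := Submodule.mem_span_singleton.1 hxl
      rw [map_smul, pseudoMetric_comm, hw, smul_zero]
    · have hpos := pos_of_orthogonal hl ht hlt hlx htx hxl
      obtain rfl | ⟨rfl, hn⟩ := hG
      · exact hzero x hlx (dualEndo_eq_zero_of_le (wedgeCovec_isAlt _ _) hη hle hpos.ne' hωx)
      · obtain ⟨s, hls, hts, hxs, hs⟩ := exists_spacelike_orthogonal hn hl ht hlt hlx htx hpos
        obtain ⟨α, hα⟩ := exists_dualEndo_eq_smul_of_le (a := 0) (b := 0) hGO hGSO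
          (wedgeCovec_isAlt _ _) hη hle hpos.ne' hs.ne' hxs (by rw [hωx, zero_smul])
          (by rw [dualEndo_wedge, hls, hts, zero_smul, zero_smul, zero_smul, sub_zero])
        refine hzero x hlx ?_
        -- `dualEndo η x` is a multiple of `l`, hence orthogonal to `s`, but also equals `α • s`; so
        -- `α = 0`.
        have h1 := congrArg (fun z => pseudoMetric n z s) hα
        simp only [hF, hlx, zero_smul, zero_sub, map_neg, map_smul, LinearMap.neg_apply,
          LinearMap.smul_apply, hls, smul_eq_mul, mul_zero, neg_zero] at h1
        rw [hα, (mul_eq_zero.1 h1.symm).resolve_right hs.ne', zero_smul]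
  refine ⟨b, eq_smul_of_dualEndo fun x => ?_⟩
  rw [hF, dualEndo_wedge]
  simp only [map_add, map_smul, LinearMap.add_apply, LinearMap.smul_apply, smul_eq_mul]
  module

/-! ### Kähler types and their rigidity. -/

/-- Common description of the forms of Kähler type: `ω` vanishes on the positive definite subspace
`E`, and on its orthogonal complement it is a multiple of a pseudo-Kähler form. -/
def IsPartialKaehler {n : ℕ} (ω : BilinForm ℝ (Fin n → ℝ)) (E : Submodule ℝ (Fin n → ℝ)) : Prop :=
  (∀ x ∈ E, x ≠ 0 → 0 < pseudoMetric n x x) ∧ (∀ x ∈ E, ω x = 0) ∧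
    IsKaehlerMultipleOn ω ((pseudoMetric n).orthogonal E)

theorem isTypeIIa_iff {n : ℕ} {ω : BilinForm ℝ (Fin n → ℝ)} :
    IsTypeIIa ω ↔ IsPartialKaehler ω ⊥ := by
  rw [IsPartialKaehler, LinearMap.BilinForm.orthogonal_bot, IsTypeIIa]
  refine ⟨fun h => ⟨?_, ?_, h⟩, fun h => h.2.2⟩
  · rintro x hx h
    exact absurd ((Submodule.mem_bot ℝ).1 hx) h
  · rintro x hx
    rw [(Submodule.mem_bot ℝ).1 hx, map_zero]

theorem isTypeIIbWith_iff {n : ℕ} {ω : BilinForm ℝ (Fin n → ℝ)}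
    {E : Submodule ℝ (Fin n → ℝ)} : IsTypeIIbWith ω E ↔ E ≠ ⊥ ∧ IsPartialKaehler ω E :=
  Iff.rfl

/-- An endomorphism that is skew, vanishes on the positive definite subspace `E` and squares to
`-1` on its orthogonal complement. -/
structure IsPartialComplexStructure {n : ℕ} (J : Module.End ℝ (Fin n → ℝ))
    (E : Submodule ℝ (Fin n → ℝ)) : Prop where
  pos : ∀ x ∈ E, x ≠ 0 → 0 < pseudoMetric n x x
  eq_zero : ∀ x ∈ E, J x = 0
  sq : ∀ x ∈ (pseudoMetric n).orthogonal E, J (J x) = -x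
  skew : ∀ x y, pseudoMetric n (J x) y = -pseudoMetric n x (J y)

theorem isCompl_orthogonal_of_pos {n : ℕ} {E : Submodule ℝ (Fin n → ℝ)}
    (hE : ∀ x ∈ E, x ≠ 0 → 0 < pseudoMetric n x x) :
    IsCompl E ((pseudoMetric n).orthogonal E) := by
  rw [LinearMap.BilinForm.isCompl_orthogonal_iff_disjoint (pseudoMetric_isRefl n),
    Submodule.disjoint_def]
  intro x hx hx'
  by_contra h
  exact (hE x hx h).ne' (hx' x hx)

theorem exists_add_orthogonal_of_pos {n : ℕ} {E : Submodule ℝ (Fin n → ℝ)}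
    (hE : ∀ x ∈ E, x ≠ 0 → 0 < pseudoMetric n x x) (x : Fin n → ℝ) :
    ∃ p ∈ E, ∃ q ∈ (pseudoMetric n).orthogonal E, p + q = x :=
  Submodule.mem_sup.1 ((isCompl_orthogonal_of_pos hE).sup_eq_top ▸ Submodule.mem_top)

theorem exists_timelike_orthogonal_of_pos {n : ℕ} {E : Submodule ℝ (Fin n → ℝ)}
    (hE : ∀ x ∈ E, x ≠ 0 → 0 < pseudoMetric n x x) {T : Fin n → ℝ} (hT : IsTimelikeVec T) :
    ∃ p ∈ E, ∃ q ∈ (pseudoMetric n).orthogonal E, p + q = T ∧ pseudoMetric n q q < 0 := by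
  obtain ⟨p, hp, q, hq, rfl⟩ := exists_add_orthogonal_of_pos hE T
  refine ⟨p, hp, q, hq, rfl, ?_⟩
  have h1 : pseudoMetric n p q = 0 := hq p hp
  have h2 : 0 ≤ pseudoMetric n p p := by
    by_cases h : p = 0
    · simp [h]
    · exact (hE p hp h).le
  rw [IsTimelikeVec] at hT
  simp only [map_add, LinearMap.add_apply, pseudoMetric_comm q p, h1] at hT
  linarith

namespace IsPartialComplexStructure

variable {n : ℕ} {J : Module.End ℝ (Fin n → ℝ)} {E : Submodule ℝ (Fin n → ℝ)}

theorem mem_orthogonal (hJ : IsPartialComplexStructure J E) (x : Fin n → ℝ) :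
    J x ∈ (pseudoMetric n).orthogonal E := fun y hy => by
  have := hJ.skew y x
  rw [hJ.eq_zero y hy, map_zero, LinearMap.zero_apply] at this
  exact neg_eq_zero.1 this.symm

theorem isometry (hJ : IsPartialComplexStructure J E) (x : Fin n → ℝ) {y : Fin n → ℝ}
    (hy : y ∈ (pseudoMetric n).orthogonal E) :
    pseudoMetric n (J x) (J y) = pseudoMetric n x y := by
  rw [hJ.skew, hJ.sq y hy, map_neg, neg_neg]

theorem self_orthogonal (hJ : IsPartialComplexStructure J E) (x : Fin n → ℝ) :
    pseudoMetric n x (J x) = 0 := by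
  have := hJ.skew x x
  rw [pseudoMetric_comm] at this
  linarith

end IsPartialComplexStructure

/-- Replaces the complex structure on the subspace by the globally defined `J = c⁻¹ • dualEndo ω`,
its extension by zero to `E`. -/
theorem IsPartialKaehler.exists_complexStructure {n : ℕ} {ω : BilinForm ℝ (Fin n → ℝ)}
    (hω : ω.IsAlt) {E : Submodule ℝ (Fin n → ℝ)} (h : IsPartialKaehler ω E) :
    ∃ c : ℝ, c ≠ 0 ∧ ∃ J, IsPartialComplexStructure J E ∧ ∀ x, dualEndo ω x = c • J x := by
  obtain ⟨hE, hker, c, hc, J₀, hsq, -, hJω⟩ := h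
  have h0 : ∀ x ∈ E, dualEndo ω x = 0 := fun x hx => eq_dualEndo fun y => by
    rw [hker x hx, map_zero]
  have h1 : ∀ x : (pseudoMetric n).orthogonal E, dualEndo ω x = c • (J₀ x : Fin n → ℝ) := by
    intro x
    refine eq_dualEndo fun y => ?_
    obtain ⟨p, hp, q, hq, rfl⟩ := exists_add_orthogonal_of_pos hE y
    rw [map_add, ← hω.neg_eq p x, hker p hp, map_add, hJω x ⟨q, hq⟩,
      pseudoMetric_comm _ p, map_smul, (J₀ x).2 p hp]
    simp
  refine ⟨c, hc, c⁻¹ • dualEndo ω, ⟨hE, ?_, ?_, ?_⟩, fun x => ?_⟩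
  · intro x hx
    rw [LinearMap.smul_apply, h0 x hx, smul_zero]
  · intro x hx
    have h2 := h1 ⟨x, hx⟩
    have h3 := h1 (J₀ ⟨x, hx⟩)
    simp only at h2
    rw [LinearMap.smul_apply, LinearMap.smul_apply, h2, smul_smul, inv_mul_cancel₀ hc, one_smul,
      h3, smul_smul, inv_mul_cancel₀ hc, one_smul, hsq]
    rfl
  · intro x y
    simp only [LinearMap.smul_apply, map_smul, dualEndo_skew hω x y, smul_neg]
  · rw [LinearMap.smul_apply, smul_smul, mul_inv_cancel₀ hc, one_smul]

theorem IsPartialComplexStructure.isPartialKaehler {n : ℕ} {ω : BilinForm ℝ (Fin n → ℝ)}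
    {E : Submodule ℝ (Fin n → ℝ)} {J : Module.End ℝ (Fin n → ℝ)}
    (hJ : IsPartialComplexStructure J E) {c : ℝ} (hc : c ≠ 0)
    (h : ∀ x, dualEndo ω x = c • J x) : IsPartialKaehler ω E := by
  have h1 : ∀ x y, ω x y = c * pseudoMetric n (J x) y := fun x y => by
    rw [← pseudoMetric_dualEndo, h, map_smul, LinearMap.smul_apply, smul_eq_mul]
  refine ⟨hJ.pos, fun x hx => LinearMap.ext fun y => ?_, c, hc,
    J.restrict fun x _ => hJ.mem_orthogonal x, ?_, ?_, ?_⟩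
  · rw [h1, hJ.eq_zero x hx]
    simp
  · rintro ⟨x, hx⟩
    exact Subtype.ext (hJ.sq x hx)
  · rintro ⟨x, hx⟩ ⟨y, hy⟩
    exact hJ.isometry x hy
  · rintro ⟨x, hx⟩ ⟨y, hy⟩
    exact h1 x y

theorem IsPartialKaehler.hasCausalContractions {n : ℕ} {ω : BilinForm ℝ (Fin n → ℝ)}
    (hω : ω.IsAlt) {E : Submodule ℝ (Fin n → ℝ)} (h : IsPartialKaehler ω E) :
    HasCausalContractions ω := by
  obtain ⟨c, hc, J, hJ, hF⟩ := h.exists_complexStructure hω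
  refine hasCausalContractions_of_dualEndo fun T hT => ?_
  obtain ⟨p, hp, q, hq, rfl, hneg⟩ := exists_timelike_orthogonal_of_pos hJ.pos hT
  have h1 : pseudoMetric n (dualEndo ω (p + q)) (dualEndo ω (p + q)) < 0 := by
    rw [hF, map_add, hJ.eq_zero p hp, zero_add]
    simp only [map_smul, LinearMap.smul_apply, hJ.isometry q hq, smul_eq_mul]
    nlinarith [mul_pos (mul_self_pos.2 hc) (neg_pos.2 hneg)]
  refine ⟨fun h0 => ?_, h1.le⟩
  rw [h0] at h1
  simp at h1

/-- As a function of `s` this is a quadratic polynomial with leading coefficient `g(t, t) ≠ 0`, so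
it cannot vanish at 1, -1 and 2. -/
theorem exists_nonnull_add_smul {n : ℕ} {t : Fin n → ℝ} (ht : pseudoMetric n t t ≠ 0)
    (v : Fin n → ℝ) : ∃ s : ℝ, s ≠ 0 ∧ pseudoMetric n (v + s • t) (v + s • t) ≠ 0 := by
  by_contra! h
  have h1 := h 1 (by norm_num)
  have h2 := h (-1) (by norm_num)
  have h3 := h 2 (by norm_num)
  simp only [map_add, map_smul, LinearMap.add_apply, LinearMap.smul_apply, smul_eq_mul,
    pseudoMetric_comm t v] at h1 h2 h3
  exact ht (by linarith)

/-- A linear map pointwise proportional to `J` is a constant multiple of it: the factors at `v`, `t`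
and a nonnull `v + s • t` are compared. Null vectors follow by linearity, as differences of nonnull
ones. -/
theorem IsPartialComplexStructure.exists_eq_smul {n : ℕ} {J : Module.End ℝ (Fin n → ℝ)}
    {E : Submodule ℝ (Fin n → ℝ)} (hJ : IsPartialComplexStructure J E)
    {F : Module.End ℝ (Fin n → ℝ)} {t : Fin n → ℝ} (htE : t ∈ (pseudoMetric n).orthogonal E)
    (ht : pseudoMetric n t t ≠ 0)
    (hF : ∀ v ∈ (pseudoMetric n).orthogonal E, pseudoMetric n v v ≠ 0 → ∃ α : ℝ, F v = α • J v) :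
    ∃ b : ℝ, ∀ v ∈ (pseudoMetric n).orthogonal E, F v = b • J v := by
  obtain ⟨b, hb⟩ := hF t htE ht
  have key : ∀ v ∈ (pseudoMetric n).orthogonal E, pseudoMetric n v v ≠ 0 → F v = b • J v := by
    intro v hvE hv
    obtain ⟨α, hα⟩ := hF v hvE hv
    obtain ⟨s, hs, hvs⟩ := exists_nonnull_add_smul ht v
    obtain ⟨β, hβ⟩ := hF (v + s • t) (add_mem hvE (Submodule.smul_mem _ _ htE)) hvs
    have hv0 : v ≠ 0 := by
      rintro rfl
      simp at hv
    simp only [map_add, map_smul, hα, hb] at hβ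
    -- Applying `J`, with `J² = -1`, turns the relation between `J v` and `J t` into one between `v`
    -- and `t`.
    have h1 := congrArg J hβ
    simp only [map_add, map_smul, hJ.sq v hvE, hJ.sq t htE] at h1
    have h2 : (s * (b - β)) • t = (β - α) • v := by linear_combination (norm := module) -h1
    by_cases hbβ : b = β
    · rw [hbβ, sub_self, mul_zero, zero_smul, eq_comm, smul_eq_zero, sub_eq_zero] at h2
      rw [hα, hbβ, h2.resolve_right hv0]
    · have h3 : t = ((s * (b - β))⁻¹ * (β - α)) • v := by
        rw [mul_smul, ← h2, smul_smul, inv_mul_cancel₀ (mul_ne_zero hs (sub_ne_zero.2 hbβ)),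
          one_smul]
      generalize (s * (b - β))⁻¹ * (β - α) = k at h3
      have hk : k ≠ 0 := by
        rintro rfl
        simp [h3] at ht
      rw [h3, map_smul, map_smul, smul_comm b] at hb
      exact smul_right_injective _ hk hb
  refine ⟨b, fun v hvE => ?_⟩
  obtain ⟨s, -, hvs⟩ := exists_nonnull_add_smul ht v
  have h1 := key _ (add_mem hvE (Submodule.smul_mem _ s htE)) hvs
  simp only [map_add, map_smul, hb] at h1
  linear_combination (norm := module) h1

/-- A positive definite subspace whose dimension is not two contains, for any two of its
linearly independent vectors, a nonzero vector orthogonal to both. -/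
theorem exists_orthogonal_in_pos {n : ℕ} {E : Submodule ℝ (Fin n → ℝ)}
    (hE : ∀ x ∈ E, x ≠ 0 → 0 < pseudoMetric n x x) (hdim : Module.finrank ℝ E ≠ 2)
    {v p : Fin n → ℝ} (hv : v ∈ E) (hp : p ∈ E) (hvp : LinearIndependent ℝ ![v, p]) :
    ∃ f ∈ E, f ≠ 0 ∧ pseudoMetric n v f = 0 ∧ pseudoMetric n p f = 0 := by
  have hle : Submodule.span ℝ {v, p} ≤ E := by
    rw [Submodule.span_le]
    rintro x (rfl | rfl)
    exacts [hv, hp]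
  have hnot : ¬ E ≤ Submodule.span ℝ {v, p} := fun h => by
    rw [le_antisymm h hle, finrank_span_pair_of_linearIndependent hvp] at hdim
    exact hdim rfl
  obtain ⟨y, hy, hy'⟩ := SetLike.not_le_iff_exists.1 hnot
  obtain ⟨q, hq, f, hf, rfl⟩ := exists_add_orthogonal_of_pos (fun x hx => hE x (hle hx)) y
  refine ⟨f, ?_, ?_, hf v (Submodule.subset_span (by simp)),
    hf p (Submodule.subset_span (by simp))⟩
  · simpa using E.sub_mem hy (hle hq)
  · rintro rfl
    exact hy' (by simpa using hq)

/-- On `E^⊥`, bireflections in `v` and `J v` make `dualEndo η` proportional to `J`; on `E`,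
reflections (or, in SO, bireflections inside `E`) make it zero. -/
theorem IsPartialKaehler.eq_smul_of_le {n : ℕ} (hn : 2 ≤ n)
    {G : Subgroup ((Fin n → ℝ) ≃ₗ[ℝ] (Fin n → ℝ))} {ω η : BilinForm ℝ (Fin n → ℝ)}
    (hω : ω.IsAlt) {E : Submodule ℝ (Fin n → ℝ)}
    (hG : G = pseudoO n ∨ G = pseudoSO n ∧ Module.finrank ℝ E ≠ 2)
    (hωE : IsPartialKaehler ω E) (hη : η.IsAlt)
    (hle : G ⊓ formStabilizer ω ≤ G ⊓ formStabilizer η) : ∃ c : ℝ, η = c • ω := by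
  have hGO : G ≤ pseudoO n := by
    obtain rfl | ⟨rfl, -⟩ := hG
    exacts [le_rfl, inf_le_left]
  have hGSO : pseudoSO n ≤ G := by
    obtain rfl | ⟨rfl, -⟩ := hG
    exacts [inf_le_left, le_rfl]
  obtain ⟨c, hc, J, hJ, hF⟩ := hωE.exists_complexStructure hω
  obtain ⟨T, hT⟩ := exists_isTimelikeVec hn
  obtain ⟨-, -, t, htE, -, ht⟩ := exists_timelike_orthogonal_of_pos hJ.pos hT
  obtain ⟨b, hb⟩ := hJ.exists_eq_smul (F := dualEndo η) htE ht.ne fun v hvE hv =>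
    exists_dualEndo_eq_smul_of_le (a := c) (b := -c) hGO hGSO hω hη hle hv
      (by rwa [hJ.isometry v hvE]) (hJ.self_orthogonal v) (hF v)
      (by rw [hF, hJ.sq v hvE, smul_neg, neg_smul])
  have hωker : ∀ v ∈ E, dualEndo ω v = 0 := fun v hv => by rw [hF, hJ.eq_zero v hv, smul_zero]
  have hker : ∀ v ∈ E, dualEndo η v = 0 := by
    intro v hv
    by_cases hv0 : v = 0
    · rw [hv0, map_zero]
    obtain rfl | ⟨rfl, hdim⟩ := hG
    · exact dualEndo_eq_zero_of_le hω hη hle (hJ.pos v hv hv0).ne' (hωker v hv)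
    refine eq_zero_of_pseudoMetric fun y => ?_
    obtain ⟨p, hp, q, hq, rfl⟩ := exists_add_orthogonal_of_pos hJ.pos y
    have h1 : pseudoMetric n (dualEndo η v) q = 0 := by
      rw [dualEndo_skew hη, hb q hq, map_smul, hJ.mem_orthogonal q v hv, smul_zero, neg_zero]
    rw [map_add, h1, add_zero]
    by_cases hvp : LinearIndependent ℝ ![v, p]
    -- The bireflection in `v` and `f` makes `dualEndo η v` a multiple of `f`, which is orthogonal
    -- to `p`. For `dim E = 2` there is no such `f`.
    · obtain ⟨f, hf, hf0, hvf, hpf⟩ := exists_orthogonal_in_pos hJ.pos hdim hv hp hvp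
      obtain ⟨α, hα⟩ := exists_dualEndo_eq_smul_of_le (a := 0) (b := 0) hGO hGSO hω hη hle
        (hJ.pos v hv hv0).ne' (hJ.pos f hf hf0).ne' hvf (by rw [hωker v hv, zero_smul])
        (by rw [hωker f hf, zero_smul])
      rw [hα, map_smul, LinearMap.smul_apply, pseudoMetric_comm, hpf, smul_zero]
    · rw [LinearIndependent.pair_iff' hv0] at hvp
      push Not at hvp
      obtain ⟨a, rfl⟩ := hvp
      rw [map_smul, dualEndo_self hη, smul_zero]
  refine ⟨b / c, eq_smul_of_dualEndo fun x => ?_⟩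
  obtain ⟨p, hp, q, hq, rfl⟩ := exists_add_orthogonal_of_pos hJ.pos x
  rw [map_add, map_add, hker p hp, hωker p hp, hb q hq, hF, zero_add, zero_add, smul_smul,
    div_mul_cancel₀ _ hc]

/-- `J` makes `V` a complex vector space on which `f` is complex linear, and the real determinant is
the squared modulus of the complex one. -/
theorem det_nonneg_of_commute {V : Type*} [AddCommGroup V] [Module ℝ V] [FiniteDimensional ℝ V]
    {J f : Module.End ℝ V} (hJ : J * J = -1) (hf : Commute f J) : 0 ≤ LinearMap.det f := by
  let _ : Module ℂ V := Module.compHom V (Complex.liftAux J hJ).toRingHom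
  have hsmul : ∀ (z : ℂ) (v : V), z • v = z.re • v + z.im • J v := fun z v => by
    change Complex.liftAux J hJ z v = _
    rw [Complex.liftAux_apply]
    simp
  have : IsScalarTower ℝ ℂ V := ⟨fun r z v => by
    rw [hsmul, hsmul, smul_add, smul_smul, smul_smul]
    simp⟩
  have : Module.Finite ℂ V := Module.Finite.of_restrictScalars_finite ℝ ℂ V
  let g : V →ₗ[ℂ] V :=
    { toFun := f
      map_add' := map_add f
      map_smul' := fun z v => by
        have h1 : f (J v) = J (f v) := LinearMap.congr_fun hf v
        rw [RingHom.id_apply, hsmul, hsmul, map_add, map_smul, map_smul, h1] }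
  have h : LinearMap.det (g.restrictScalars ℝ) = Algebra.norm ℝ (LinearMap.det g) :=
    LinearMap.det_restrictScalars
  change LinearMap.det f = _ at h
  rw [h, Algebra.norm_complex_apply]
  exact Complex.normSq_nonneg _

/-! ### Maximality from rigidity, and causality of the decomposable types. -/

theorem HasCausalContractions.ne_zero {n : ℕ} (hn : 2 ≤ n) {ω : BilinForm ℝ (Fin n → ℝ)}
    (h : HasCausalContractions ω) : ω ≠ 0 := by
  rintro rfl
  obtain ⟨T, hT⟩ := exists_isTimelikeVec hn
  obtain ⟨v, hv, hv0, -⟩ := h T hT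
  exact hv0 (eq_zero_of_pseudoMetric fun y => by rw [hv]; rfl)

theorem HasMaximalStabilizer.le_of_le {n : ℕ} (hn : 2 ≤ n)
    {G : Subgroup ((Fin n → ℝ) ≃ₗ[ℝ] (Fin n → ℝ))} {ω η : BilinForm ℝ (Fin n → ℝ)}
    (h : HasMaximalStabilizer G ω) (hη : η.IsAlt) (hη' : HasCausalContractions η)
    (hle : G ⊓ formStabilizer ω ≤ G ⊓ formStabilizer η) :
    G ⊓ formStabilizer η ≤ G ⊓ formStabilizer ω := by
  by_contra hnot
  exact h ⟨η, hη, hη'.ne_zero hn, hη', lt_of_le_not_ge hle hnot⟩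

theorem formStabilizer_smul {n : ℕ} {c : ℝ} (hc : c ≠ 0) (ω : BilinForm ℝ (Fin n → ℝ)) :
    formStabilizer (c • ω) = formStabilizer ω := by
  ext h
  change (∀ x y, c * ω (h x) (h y) = c * ω x y) ↔ ∀ x y, ω (h x) (h y) = ω x y
  simp only [mul_right_inj' hc]

theorem hasMaximalStabilizer_of_eq_smul {n : ℕ}
    {G : Subgroup ((Fin n → ℝ) ≃ₗ[ℝ] (Fin n → ℝ))} {ω : BilinForm ℝ (Fin n → ℝ)}
    (h : ∀ η : BilinForm ℝ (Fin n → ℝ), η.IsAlt →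
      G ⊓ formStabilizer ω ≤ G ⊓ formStabilizer η → ∃ c : ℝ, η = c • ω) :
    HasMaximalStabilizer G ω := by
  rintro ⟨η, hη, hη0, -, hlt⟩
  obtain ⟨c, rfl⟩ := h η hη hlt.le
  rw [formStabilizer_smul (by rintro rfl; exact hη0 (zero_smul _ _))] at hlt
  exact lt_irrefl _ hlt

/-- Contractions lie in the nonpositive plane. If one vanished, `T` would be orthogonal to the
plane, hence in it by maximality of its dimension, hence null. -/
theorem wedge_hasCausalContractions {n : ℕ} {u v : Fin n → ℝ} (huv : LinearIndependent ℝ ![u, v])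
    (hneg : ∀ a b : ℝ, pseudoMetric n (a • u + b • v) (a • u + b • v) ≤ 0) :
    HasCausalContractions (wedgeCovec (pseudoMetric n u) (pseudoMetric n v)) := by
  refine hasCausalContractions_of_dualEndo fun T hT => ?_
  have h1 : dualEndo (wedgeCovec (pseudoMetric n u) (pseudoMetric n v)) T =
      (-pseudoMetric n v T) • u + pseudoMetric n u T • v := by
    rw [dualEndo_wedge]
    module
  rw [h1]
  refine ⟨fun h0 => ?_, hneg _ _⟩
  obtain ⟨h2, h3⟩ := LinearIndependent.pair_iff.1 huv _ _ h0
  rw [neg_eq_zero] at h2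
  obtain ⟨a, b, rfl⟩ := exists_eq_of_nonpos_plane huv hneg h3 h2 (le_of_lt hT)
  refine (ne_of_lt hT : pseudoMetric n _ _ ≠ 0) ?_
  rw [map_add, map_smul, map_smul, pseudoMetric_comm _ u, pseudoMetric_comm _ v, h2, h3,
    smul_zero, smul_zero, add_zero]

theorem IsTypeIa.hasCausalContractions {n : ℕ} {ω : BilinForm ℝ (Fin n → ℝ)} (h : IsTypeIa ω) :
    HasCausalContractions ω := by
  obtain ⟨l₁, l₂, hli, hnull, rfl⟩ := h
  exact wedge_hasCausalContractions hli fun a b =>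
    (hnull _ (Submodule.mem_span_pair.2 ⟨a, b, rfl⟩)).le

theorem IsTypeIb.hasCausalContractions {n : ℕ} {ω : BilinForm ℝ (Fin n → ℝ)} (h : IsTypeIb ω) :
    HasCausalContractions ω := by
  obtain ⟨l, t, hl, ht, hlt, rfl⟩ := h
  exact wedge_hasCausalContractions (linearIndependent_null_nonnull hl.1 (ne_of_lt ht) hlt)
    (lightlike_timelike_nonpos hl ht hlt)

theorem isTypeIa_wedge {n : ℕ} {l₁ l₂ : Fin n → ℝ} (hli : LinearIndependent ℝ ![l₁, l₂])
    (h11 : pseudoMetric n l₁ l₁ = 0) (h12 : pseudoMetric n l₁ l₂ = 0)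
    (h22 : pseudoMetric n l₂ l₂ = 0) :
    IsTypeIa (wedgeCovec (pseudoMetric n l₁) (pseudoMetric n l₂)) := by
  refine ⟨l₁, l₂, hli, fun v hv => ?_, rfl⟩
  obtain ⟨a, b, rfl⟩ := Submodule.mem_span_pair.1 hv
  simp [LinearMap.add_apply, h11, h22, h12, pseudoMetric_comm l₂ l₁]

/-! ### The exceptional cases for SO. -/

theorem det_gram_map {n : ℕ} (h : Module.End ℝ (Fin n → ℝ)) (v : Fin n → Fin n → ℝ) :
    (Matrix.of fun i j => pseudoMetric n (h (v i)) (v j)).det =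
      LinearMap.det h * (Matrix.of fun i j => pseudoMetric n (v i) (v j)).det := by
  have key : ∀ f : Module.End ℝ (Fin n → ℝ),
      (Matrix.of fun i j => pseudoMetric n (f (v i)) (v j)) =
      LinearMap.BilinForm.toMatrix' ((pseudoMetric n).comp
        (f ∘ₗ Fintype.linearCombination ℝ v) (Fintype.linearCombination ℝ v)) := by
    intro f
    ext i j
    simp [LinearMap.BilinForm.toMatrix'_apply, Fintype.linearCombination_apply_single]
  rw [key h, show (Matrix.of fun i j => pseudoMetric n (v i) (v j)) = _ from key LinearMap.id]
  simp only [LinearMap.BilinForm.toMatrix'_comp, Matrix.det_mul, Matrix.det_transpose,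
    LinearMap.det_toMatrix', LinearMap.det_comp, LinearMap.det_id]
  ring

/-- On the plane of `u` and `v` the map is triangular with determinant `ε² = 1`. -/
theorem mem_formStabilizer_wedge {n : ℕ} {h : (Fin n → ℝ) ≃ₗ[ℝ] (Fin n → ℝ)} (hh : h ∈ pseudoO n)
    {u v : Fin n → ℝ} {ε k : ℝ} (hε : ε * ε = 1) (hu : h u = ε • u) (hv : h v = ε • v + k • u) :
    h ∈ formStabilizer (wedgeCovec (pseudoMetric n u) (pseudoMetric n v)) := by
  rw [mem_formStabilizer_iff_dualEndo hh]
  intro x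
  have h1 := hh u x
  have h2 := hh v x
  simp only [hu, hv, map_add, map_smul, LinearMap.add_apply, LinearMap.smul_apply,
    smul_eq_mul] at h1 h2
  have h3 : pseudoMetric n u (h x) = ε * pseudoMetric n u x := by
    linear_combination ε * h1 - pseudoMetric n u (h x) * hε
  have h4 : pseudoMetric n v (h x) = ε * pseudoMetric n v x - k * pseudoMetric n u x := by
    linear_combination ε * h2 - pseudoMetric n v (h x) * hε - k * h1
  rw [dualEndo_wedge, dualEndo_wedge, map_sub, map_smul, map_smul, hu, hv, h3, h4]
  module

/-- In dimension four `{l, t}^⊥` is spanned by `l` and one spacelike `e`, scaled so that `t + e` is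
null. Stabilizing `l ∧ t` means acting by signs `ε` on `t` and `δ` on `e` modulo `l`; determinant
one forces `δ = ε`, so the Type (I_a) form `l ∧ (t + e)` is stabilized too. -/
theorem IsTypeIb.not_hasMaximalStabilizer {ω : BilinForm ℝ (Fin 4 → ℝ)} (hω : IsTypeIb ω) :
    ¬ HasMaximalStabilizer (pseudoSO 4) ω := by
  intro hmax
  obtain ⟨l, t, hl, ht, hlt, rfl⟩ := hω
  have ht' : pseudoMetric 4 t t ≠ 0 := ne_of_lt ht
  have htl : pseudoMetric 4 t l = 0 := by rw [pseudoMetric_comm, hlt]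
  have hlti := linearIndependent_null_nonnull hl.1 ht' hlt
  have hdim : Module.finrank ℝ ((pseudoMetric 4).orthogonal (Submodule.span ℝ {l, t})) = 2 := by
    rw [LinearMap.BilinForm.finrank_orthogonal (pseudoMetric_nondegenerate 4),
      finrank_span_pair_of_linearIndependent hlti, Module.finrank_fin_fun]
  have hmem : ∀ x, pseudoMetric 4 l x = 0 → pseudoMetric 4 t x = 0 →
      x ∈ (pseudoMetric 4).orthogonal (Submodule.span ℝ {l, t}) := by
    intro x hlx htx y hy
    obtain ⟨a, b, rfl⟩ := Submodule.mem_span_pair.1 hy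
    simp [LinearMap.add_apply, hlx, htx]
  obtain ⟨e, hle, hte, hee⟩ : ∃ e, pseudoMetric 4 l e = 0 ∧ pseudoMetric 4 t e = 0 ∧
      pseudoMetric 4 e e = -pseudoMetric 4 t t := by
    obtain ⟨x, hx, hxl⟩ := SetLike.not_le_iff_exists.1
      (show ¬ (pseudoMetric 4).orthogonal (Submodule.span ℝ {l, t}) ≤ Submodule.span ℝ {l} from
        fun h => by
          have h8 := Submodule.finrank_mono h
          have h9 := finrank_span_singleton (K := ℝ) hl.1
          omega)
    have hlx : pseudoMetric 4 l x = 0 := hx l (Submodule.subset_span (by simp))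
    have htx : pseudoMetric 4 t x = 0 := hx t (Submodule.subset_span (by simp))
    have hpos := pos_of_orthogonal hl ht hlt hlx htx hxl
    refine ⟨Real.sqrt (-pseudoMetric 4 t t / pseudoMetric 4 x x) • x, by simp [hlx],
      by simp [htx], ?_⟩
    simp only [map_smul, LinearMap.smul_apply, smul_eq_mul]
    rw [← mul_assoc, Real.mul_self_sqrt (div_nonneg (neg_nonneg.2 (le_of_lt ht)) hpos.le),
      div_mul_cancel₀ _ hpos.ne']
  have hee' : pseudoMetric 4 e e ≠ 0 := by rwa [hee, neg_ne_zero]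
  have hspan : Submodule.span ℝ {l, e} =
      (pseudoMetric 4).orthogonal (Submodule.span ℝ {l, t}) := by
    refine Submodule.eq_of_le_of_finrank_eq ?_ ?_
    · rw [Submodule.span_le]
      rintro x (rfl | rfl)
      exacts [hmem _ hl.2 htl, hmem _ hle hte]
    · rw [hdim, finrank_span_pair_of_linearIndependent
        (linearIndependent_null_nonnull hl.1 hee' hle)]
  obtain ⟨m, hlm⟩ := exists_pseudoMetric_eq_one hl.1
  set η := wedgeCovec (pseudoMetric 4 l) (pseudoMetric 4 (t + e)) with hη
  have hs : pseudoMetric 4 (t + e) (t + e) = 0 := by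
    simp only [map_add, LinearMap.add_apply, hte, pseudoMetric_comm e t, hee]
    ring
  have hls : pseudoMetric 4 l (t + e) = 0 := by rw [map_add, hlt, hle, add_zero]
  have hηIa : IsTypeIa η := by
    refine isTypeIa_wedge ?_ hl.2 hls hs
    rw [LinearIndependent.pair_iff]
    intro a b hab
    have h1 := congrArg (pseudoMetric 4 t) hab
    simp only [map_add, map_smul, smul_eq_mul, htl, hte, mul_zero, zero_add, add_zero, map_zero,
      mul_eq_zero, ht', or_false] at h1
    rw [h1, zero_smul, add_zero] at hab
    exact ⟨(smul_eq_zero.1 hab).resolve_right hl.1, h1⟩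
  have hstab : pseudoSO 4 ⊓
      formStabilizer (wedgeCovec (pseudoMetric 4 l) (pseudoMetric 4 t)) ≤
        pseudoSO 4 ⊓ formStabilizer η := by
    rintro h ⟨hSO, hst⟩
    obtain ⟨hO, hdet⟩ := mem_pseudoSO_iff.1 hSO
    refine ⟨hSO, ?_⟩
    have hF := (mem_formStabilizer_iff_dualEndo hO).1 hst
    simp only [dualEndo_wedge, map_sub, map_smul] at hF
    obtain ⟨ε, hε⟩ : ∃ ε : ℝ, h l = ε • l := by
      have h1 := hF t
      rw [hlt, zero_smul, zero_sub] at h1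
      obtain ⟨a, b, h2⟩ : ∃ a b : ℝ, h l = a • t + b • l := by
        refine ⟨-(pseudoMetric 4 t t)⁻¹ * pseudoMetric 4 l (h t),
          (pseudoMetric 4 t t)⁻¹ * pseudoMetric 4 t (h t), ?_⟩
        have h3 := congrArg (fun z => (pseudoMetric 4 t t)⁻¹ • z) h1
        simp only [smul_neg, smul_smul, inv_mul_cancel₀ ht', one_smul] at h3
        linear_combination (norm := module) h3
      have h4 := hO l l
      rw [h2, hl.2] at h4
      simp only [map_add, map_smul, LinearMap.add_apply, LinearMap.smul_apply, smul_eq_mul, htl,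
        hlt, hl.2, mul_zero, add_zero, mul_eq_zero, or_self, ht', or_false] at h4
      rw [h4, zero_smul, zero_add] at h2
      exact ⟨_, h2⟩
    have hε0 : ε ≠ 0 := by
      rintro rfl
      rw [zero_smul] at hε
      exact hl.1 (h.map_eq_zero_iff.1 hε)
    have hlh : ∀ x, ε * pseudoMetric 4 l (h x) = pseudoMetric 4 l x := fun x => by
      rw [← hO l x, hε, map_smul, LinearMap.smul_apply, smul_eq_mul]
    have hlht : pseudoMetric 4 l (h t) = 0 := by
      simpa [hlt, hε0] using hlh t
    have hlhe : pseudoMetric 4 l (h e) = 0 := by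
      simpa [hle, hε0] using hlh e
    have htht : pseudoMetric 4 t (h t) = ε * pseudoMetric 4 t t := by
      have h1 := hF t
      rw [hlht, hlt, hε, zero_smul, zero_smul, smul_smul, zero_sub, zero_sub, neg_inj] at h1
      rw [smul_left_injective ℝ hl.1 h1, mul_comm]
    have hthe : pseudoMetric 4 t (h e) = 0 := by
      have h1 := hF e
      rw [hlhe, hle, hte, zero_smul, zero_smul, zero_smul, zero_sub, sub_zero, neg_eq_zero] at h1
      exact (smul_eq_zero.1 h1).resolve_right hl.1
    obtain ⟨b, hb⟩ : ∃ b : ℝ, h t = ε • t + b • l := by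
      have h1 := hF m
      rw [hlm, one_smul, hε] at h1
      have h2 : h t = pseudoMetric 4 l (h m) • t +
          (pseudoMetric 4 t m * ε - pseudoMetric 4 t (h m)) • l := by
        linear_combination (norm := module) -h1
      have h3 := congrArg (pseudoMetric 4 t) h2
      rw [htht] at h3
      simp only [map_add, map_smul, smul_eq_mul, htl, mul_zero, add_zero] at h3
      rw [← mul_right_cancel₀ ht' h3] at h2
      exact ⟨_, h2⟩
    obtain ⟨c, δ, hδ⟩ : ∃ c δ : ℝ, c • l + δ • e = h e := by
      rw [← Submodule.mem_span_pair, hspan]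
      exact hmem _ hlhe hthe
    have hε2 : ε * ε = 1 := by
      have h1 := hO t t
      rw [hb] at h1
      simp only [map_add, map_smul, LinearMap.add_apply, LinearMap.smul_apply, smul_eq_mul, htl,
        hlt, hl.2, mul_zero, add_zero] at h1
      exact mul_right_cancel₀ ht' (by linarith)
    have hδ2 : δ * δ = 1 := by
      have h1 := hO e e
      rw [← hδ] at h1
      simp only [map_add, map_smul, LinearMap.add_apply, LinearMap.smul_apply, smul_eq_mul,
        pseudoMetric_comm e l, hle, hl.2, mul_zero, add_zero, zero_add] at h1
      exact mul_right_cancel₀ hee' (by linarith)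
    -- With `h l = ε • l` and `g(l, h m) = ε⁻¹`, the Gram determinant for `l, t, e, m` gives `det h
    -- = ε * δ`.
    have hδε : δ = ε := by
      have h1 := det_gram_map (h : Module.End ℝ (Fin 4 → ℝ)) ![l, t, e, m]
      have hlhm := hlh m
      rw [hlm] at hlhm
      rw [hdet, one_mul] at h1
      simp only [Matrix.det_succ_row_zero, Fin.sum_univ_succ, Matrix.submatrix_apply,
        Matrix.of_apply, LinearEquiv.coe_coe] at h1
      simp [Fin.succAbove, hε, hb, ← hδ, hl.2, htl, hlt, hle, hte, hlm,
        pseudoMetric_comm e l, pseudoMetric_comm e t, pseudoMetric_comm m l,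
        pseudoMetric_comm (h m) l] at h1
      have h2 : ε * δ = 1 := mul_right_cancel₀ (mul_ne_zero ht' hee') (by
        linear_combination -h1 - ε * δ * pseudoMetric 4 t t * pseudoMetric 4 e e * hlhm)
      linear_combination ε * h2 - δ * hε2
    refine mem_formStabilizer_wedge (ε := ε) (k := b + c) hO hε2 hε ?_
    rw [map_add, hb, ← hδ, hδε]
    module
  obtain ⟨c, hc⟩ := hηIa.eq_smul_of_le inf_le_left le_rfl (wedgeCovec_isAlt _ _)
    (hmax.le_of_le (by norm_num) (wedgeCovec_isAlt _ _) hηIa.hasCausalContractions hstab)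
  have h1 := LinearMap.congr_fun₂ hc e m
  have h2 := LinearMap.congr_fun₂ hc t m
  simp only [hη, LinearMap.smul_apply, wedgeCovec_apply, map_add, LinearMap.add_apply, hle, hte,
    hlm, hlt, zero_mul, zero_sub, mul_one, zero_add, add_zero, smul_eq_mul, pseudoMetric_comm e t,
    neg_zero, zero_eq_mul, neg_eq_zero, hee', or_false] at h1 h2
  rw [h1, zero_mul, neg_eq_zero] at h2
  exact ht' h2

theorem exists_orthonormal_pair {n : ℕ} {E : Submodule ℝ (Fin n → ℝ)}
    (hE : ∀ x ∈ E, x ≠ 0 → 0 < pseudoMetric n x x) (hdim : Module.finrank ℝ E = 2) :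
    ∃ e₁ ∈ E, ∃ e₂ ∈ E, pseudoMetric n e₁ e₁ = 1 ∧ pseudoMetric n e₂ e₂ = 1 ∧
      pseudoMetric n e₁ e₂ = 0 ∧ ∀ x ∈ E, ∃ a b : ℝ, a • e₁ + b • e₂ = x := by
  have hnormal : ∀ x ∈ E, x ≠ 0 → ∃ c : ℝ, pseudoMetric n (c • x) (c • x) = 1 := by
    intro x hx hx0
    refine ⟨(Real.sqrt (pseudoMetric n x x))⁻¹, ?_⟩
    have h1 := hE x hx hx0
    simp only [map_smul, LinearMap.smul_apply, smul_eq_mul]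
    rw [← mul_assoc, ← mul_inv, Real.mul_self_sqrt h1.le, inv_mul_cancel₀ h1.ne']
  have hne : E ≠ ⊥ := by
    rintro rfl
    simp at hdim
  obtain ⟨x, hx, hx0⟩ := Submodule.exists_mem_ne_zero_of_ne_bot hne
  obtain ⟨c, hc⟩ := hnormal x hx hx0
  have hle : Submodule.span ℝ {c • x} ≤ E := by
    rw [Submodule.span_singleton_le_iff_mem]
    exact E.smul_mem c hx
  have hnot : ¬ E ≤ Submodule.span ℝ {c • x} := fun h => by
    have h1 := Submodule.finrank_mono h
    have h2 := finrank_span_le_card (R := ℝ) ({c • x} : Set (Fin n → ℝ))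
    simp only [Set.toFinset_singleton, Finset.card_singleton] at h2
    omega
  obtain ⟨y, hy, hy'⟩ := SetLike.not_le_iff_exists.1 hnot
  obtain ⟨q, hq, f, hf, rfl⟩ := exists_add_orthogonal_of_pos (fun x hx => hE x (hle hx)) y
  have hfE : f ∈ E := by simpa using E.sub_mem hy (hle hq)
  have hf0 : f ≠ 0 := by
    rintro rfl
    exact hy' (by simpa using hq)
  obtain ⟨d, hd⟩ := hnormal f hfE hf0
  have ho : pseudoMetric n (c • x) (d • f) = 0 := by
    rw [map_smul, hf _ (Submodule.mem_span_singleton_self _), smul_zero]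
  refine ⟨c • x, E.smul_mem c hx, d • f, E.smul_mem d hfE, hc, hd, ho, fun z hz => ?_⟩
  rw [← Submodule.mem_span_pair (R := ℝ)]
  have hle' : Submodule.span ℝ {c • x, d • f} ≤ E := by
    rw [Submodule.span_le]
    rintro z (rfl | rfl)
    exacts [E.smul_mem c hx, E.smul_mem d hfE]
  rwa [Submodule.eq_of_le_of_finrank_eq hle' (by
    rw [hdim, finrank_span_pair_of_linearIndependent (linearIndependent_null_nonnull
      (fun h0 => by simp [h0] at hc) (by rw [hd]; exact one_ne_zero) ho)])]

/-- `eichlerGen e₁ e₂` corresponds to `e₁ ∧ e₂`, which is scaled by the determinant `ε` of `h` on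
the plane. -/
theorem eichlerGen_commute_of_rotation {n : ℕ} {h : (Fin n → ℝ) ≃ₗ[ℝ] (Fin n → ℝ)}
    (hh : h ∈ pseudoO n) {e₁ e₂ : Fin n → ℝ} {a b ε : ℝ}
    (hab : a * a + b * b = 1) (h₁ : h e₁ = a • e₁ + b • e₂)
    (h₂ : h e₂ = ε • (a • e₂ - b • e₁)) (x : Fin n → ℝ) :
    h (eichlerGen e₁ e₂ x) = ε • eichlerGen e₁ e₂ (h x) := by
  have h3 := hh e₁ x
  have h4 := hh e₂ x
  simp only [h₁, h₂, map_add, map_sub, map_smul, LinearMap.add_apply, LinearMap.sub_apply,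
    LinearMap.smul_apply, smul_eq_mul] at h3 h4
  rw [eichlerGen_apply, eichlerGen_apply, map_sub, map_smul, map_smul, ← h3, ← h4, h₁, h₂]
  match_scalars
  · linear_combination pseudoMetric n e₁ (h x) * ε * hab
  · linear_combination -pseudoMetric n e₂ (h x) * ε * hab

/-- Adding the rotation `R` of the plane `E` to `J` gives a complex structure on the whole space,
hence a form `η` of Type (II_a). A stabilizing `h` preserves `E = ker J`; its determinant there
cannot be -1, so it commutes with `R` and stabilizes `η`. -/
theorem IsPartialKaehler.not_hasMaximalStabilizer {n : ℕ} (hn : 2 ≤ n)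
    {ω : BilinForm ℝ (Fin n → ℝ)} (hω : ω.IsAlt) {E : Submodule ℝ (Fin n → ℝ)}
    (hωE : IsPartialKaehler ω E) (hdim : Module.finrank ℝ E = 2) :
    ¬ HasMaximalStabilizer (pseudoSO n) ω := by
  intro hmax
  obtain ⟨c, hc, J, hJ, hF⟩ := hωE.exists_complexStructure hω
  obtain ⟨e₁, he₁, e₂, he₂, h11, h22, h12, hspan⟩ := exists_orthonormal_pair hJ.pos hdim
  have h21 : pseudoMetric n e₂ e₁ = 0 := by rw [pseudoMetric_comm, h12]
  set R := eichlerGen e₁ e₂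
  set η := ω + c • wedgeCovec (pseudoMetric n e₁) (pseudoMetric n e₂)
  have hRJ : ∀ x, R (J x) = 0 := fun x => by
    rw [eichlerGen_apply, hJ.mem_orthogonal x _ he₁, hJ.mem_orthogonal x _ he₂, zero_smul,
      zero_smul, sub_zero]
  have hJR : ∀ x, J (R x) = 0 := fun x => by
    rw [eichlerGen_apply, map_sub, map_smul, map_smul, hJ.eq_zero _ he₁, hJ.eq_zero _ he₂,
      smul_zero, smul_zero, sub_zero]
  have hsq : ∀ x, (J + R) ((J + R) x) = -x := by
    intro x
    obtain ⟨p, hp, q, hq, rfl⟩ := exists_add_orthogonal_of_pos hJ.pos x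
    obtain ⟨a, b, rfl⟩ := hspan p hp
    have h1 : R q = 0 := by
      rw [eichlerGen_apply, hq _ he₁, hq _ he₂, zero_smul, zero_smul, sub_zero]
    have h2 : R e₁ = e₂ := by
      rw [eichlerGen_apply, h11, h21, one_smul, zero_smul, sub_zero]
    have h3 : R e₂ = -e₁ := by
      rw [eichlerGen_apply, h22, h12, one_smul, zero_smul, zero_sub]
    simp only [LinearMap.add_apply, map_add, map_smul, hRJ, hJ.eq_zero _ he₁,
      hJ.eq_zero _ he₂, hJ.sq q hq, h1, h2, h3, map_neg, map_zero]
    module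
  have hJ' : IsPartialComplexStructure (J + R) ⊥ := by
    refine ⟨fun x hx h0 => absurd ((Submodule.mem_bot ℝ).1 hx) h0,
      fun x hx => by rw [(Submodule.mem_bot ℝ).1 hx, map_zero], fun x _ => hsq x, fun x y => ?_⟩
    simp only [LinearMap.add_apply, map_add, hJ.skew x y, R, eichlerGen_apply, map_sub, map_smul,
      LinearMap.sub_apply, LinearMap.smul_apply, smul_eq_mul, pseudoMetric_comm x e₁,
      pseudoMetric_comm x e₂]
    ring
  have hηF : ∀ x, dualEndo η x = c • (J + R) x := fun x => eq_dualEndo fun y => by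
    simp only [η, R, LinearMap.add_apply, LinearMap.smul_apply, wedgeCovec_apply, map_add,
      map_smul, smul_eq_mul, eichlerGen_apply, map_sub, LinearMap.sub_apply]
    rw [← pseudoMetric_dualEndo ω, hF, map_smul, LinearMap.smul_apply, smul_eq_mul]
    ring
  have hη : η.IsAlt := fun x => by
    simp only [η, LinearMap.add_apply, LinearMap.smul_apply, wedgeCovec_apply, smul_eq_mul, hω x]
    ring
  have hηII := hJ'.isPartialKaehler hc hηF
  have hstab : pseudoSO n ⊓ formStabilizer ω ≤ pseudoSO n ⊓ formStabilizer η := by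
    rintro h ⟨hSO, hst⟩
    obtain ⟨hO, hdet⟩ := mem_pseudoSO_iff.1 hSO
    refine ⟨hSO, (mem_formStabilizer_iff_dualEndo hO).2 ?_⟩
    have hhJ : ∀ x, J (h x) = h (J x) := fun x => by
      have h1 := (mem_formStabilizer_iff_dualEndo hO).1 hst x
      rw [hF, hF, map_smul] at h1
      exact smul_right_injective _ hc h1
    have hhE : ∀ x ∈ E, h x ∈ E := by
      intro x hx
      obtain ⟨p, hp, q, hq, hpq⟩ := exists_add_orthogonal_of_pos hJ.pos (h x)
      have h1 := hhJ x
      rw [hJ.eq_zero x hx, map_zero, ← hpq, map_add, hJ.eq_zero p hp, zero_add] at h1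
      have h2 := hJ.sq q hq
      rw [h1, map_zero, eq_comm, neg_eq_zero] at h2
      rw [← hpq, h2, add_zero]
      exact hp
    obtain ⟨a, b, hab⟩ := hspan _ (hhE e₁ he₁)
    obtain ⟨a', b', hab'⟩ := hspan _ (hhE e₂ he₂)
    have h1 := hO e₁ e₁
    have h2 := hO e₂ e₂
    have h3 := hO e₁ e₂
    simp only [← hab, ← hab', map_add, map_smul, LinearMap.add_apply, LinearMap.smul_apply,
      smul_eq_mul, h11, h22, h12, h21, mul_zero, mul_one, add_zero, zero_add] at h1 h2 h3
    have hε : (a * b' - b * a') * (a * b' - b * a') = 1 := by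
      linear_combination (b' * b' + a' * a') * h1 + h2 - (a * a' + b * b') * h3
    have he₂' : h e₂ = (a * b' - b * a') • (a • e₂ - b • e₁) := by
      rw [← hab']
      match_scalars
      · linear_combination (-a') * h1 + a * h3
      · linear_combination (-b') * h1 + b * h3
    have hR := eichlerGen_commute_of_rotation hO h1 hab.symm he₂'
    obtain hε1 | hε1 := mul_self_eq_one_iff.1 hε
    · intro x
      rw [hηF, hηF, LinearMap.add_apply, LinearMap.add_apply, map_smul, map_add, hhJ, hR, hε1,
        one_smul]
    · exfalso
      -- If `h` reversed the orientation of `E`, its product with the reflection in `e₂` would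
      -- commute with the complex structure `J + R` and have determinant -1.
      set r := LinearMap.transvection (-(2 / pseudoMetric n e₂ e₂) • pseudoMetric n e₂) e₂ with hr
      have hr_apply : ∀ x, r x = x - (2 * pseudoMetric n e₂ x) • e₂ := fun x => by
        rw [hr, LinearMap.transvection.apply, h22]
        simp only [LinearMap.smul_apply, smul_eq_mul]
        module
      have h4 : Commute ((h : Module.End ℝ (Fin n → ℝ)) * r) (J + R) := by
        refine LinearMap.ext fun x => ?_
        have h5 : r (J x) = J x := by
          rw [hr_apply, hJ.mem_orthogonal x _ he₂, mul_zero, zero_smul, sub_zero]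
        have h6 : J (r x) = J x := by
          rw [hr_apply, map_sub, map_smul, hJ.eq_zero _ he₂, smul_zero, sub_zero]
        have h7 : r (R x) = -R (r x) := by
          simp only [hr_apply, R, eichlerGen_apply, map_sub, map_smul, h22, h12, h21, smul_eq_mul]
          module
        simp only [Module.End.mul_apply, LinearMap.add_apply, map_add, LinearEquiv.coe_coe]
        rw [h5, h7, hhJ, h6, map_neg, hR, hε1, neg_one_smul, neg_neg]
      have h5 := det_nonneg_of_commute (LinearMap.ext hsq) h4
      rw [map_mul, hdet, one_mul, hr, LinearMap.transvection.det, h22] at h5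
      simp only [LinearMap.smul_apply, smul_eq_mul, h22] at h5
      norm_num at h5
  obtain ⟨d, hd⟩ := hηII.eq_smul_of_le hn hη (Or.inr ⟨rfl, by simp⟩) hω
    (hmax.le_of_le hn hη (hηII.hasCausalContractions hη) hstab)
  have h1 := LinearMap.congr_fun₂ hd e₁ e₂
  rw [hωE.2.1 e₁ he₁] at h1
  simp only [η, LinearMap.add_apply, LinearMap.smul_apply, wedgeCovec_apply, smul_eq_mul,
    hωE.2.1 e₁ he₁, h11, h22, h12, LinearMap.zero_apply, mul_one, mul_zero, sub_zero, zero_add,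
    zero_eq_mul, hc, or_false] at h1
  refine (hωE.hasCausalContractions hω).ne_zero hn ?_
  rw [hd, h1, zero_smul]

/-! ### The S-lemma and the optimal slope. -/

theorem eq_zero_of_forall_mul_add_nonpos {b c : ℝ} (h : ∀ s : ℝ, s * b + c ≤ 0) : b = 0 := by
  by_contra hb
  have := h ((1 - c) / b)
  rw [div_mul_cancel₀ _ hb] at this
  linarith

/-- The radical of a semidefinite self-adjoint endomorphism is its kernel. -/
theorem eq_zero_of_semidefinite {n : ℕ} {A : Module.End ℝ (Fin n → ℝ)}
    (hA : ∀ x y, pseudoMetric n (A x) y = pseudoMetric n x (A y))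
    (hpos : ∀ x, 0 ≤ pseudoMetric n (A x) x) {x : Fin n → ℝ} (hx : pseudoMetric n (A x) x = 0) :
    A x = 0 := by
  refine eq_zero_of_pseudoMetric fun y => ?_
  have h1 : -(2 * pseudoMetric n (A x) y) = 0 :=
    eq_zero_of_forall_mul_add_nonpos (c := -pseudoMetric n (A y) y) fun s => by
      have h2 := hpos (y + s • x)
      simp only [map_add, map_smul, LinearMap.add_apply, LinearMap.smul_apply, smul_eq_mul, hx] at h2
      rw [hA y x, pseudoMetric_comm y] at h2
      linarith
  linarith

section Slope

variable {n : ℕ} {F : Module.End ℝ (Fin n → ℝ)}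

/-- A null `x` is the limit of the timelike vectors `x + s • T` as `s → 0+`, once the sign of `T` is
chosen so that `g(x, T) ≤ 0`. -/
theorem pseudoMetric_nonpos_of_null (hn : 2 ≤ n)
    (hF : ∀ t, pseudoMetric n t t < 0 → pseudoMetric n (F t) (F t) ≤ 0) {x : Fin n → ℝ}
    (hx : pseudoMetric n x x = 0) : pseudoMetric n (F x) (F x) ≤ 0 := by
  obtain ⟨T, hT⟩ : ∃ T, pseudoMetric n T T < 0 ∧ pseudoMetric n x T ≤ 0 := by
    obtain ⟨T, hT⟩ := exists_isTimelikeVec hn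
    obtain h | h := le_total (pseudoMetric n x T) 0
    · exact ⟨T, hT, h⟩
    · exact ⟨-T, by simpa [IsTimelikeVec] using hT, by simpa using h⟩
  have h1 : ∀ s : ℝ, 0 < s → pseudoMetric n (F x) (F x) + s * (2 * pseudoMetric n (F x) (F T)) +
      s * s * pseudoMetric n (F T) (F T) ≤ 0 := by
    intro s hs
    have h2 := hF (x + s • T) (by
      simp only [map_add, map_smul, LinearMap.add_apply, LinearMap.smul_apply, smul_eq_mul, hx,
        pseudoMetric_comm T x]
      nlinarith [mul_pos hs (mul_pos hs (neg_pos.2 hT.1)), mul_nonneg hs.le (neg_nonneg.2 hT.2)])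
    simp only [map_add, map_smul, LinearMap.add_apply, LinearMap.smul_apply, smul_eq_mul,
      pseudoMetric_comm (F T) (F x)] at h2
    linarith
  have h3 : Filter.Tendsto (fun s : ℝ => pseudoMetric n (F x) (F x) +
      s * (2 * pseudoMetric n (F x) (F T)) + s * s * pseudoMetric n (F T) (F T))
      (nhdsWithin 0 (Set.Ioi 0)) (nhds (pseudoMetric n (F x) (F x))) := by
    have : Continuous (fun s : ℝ => pseudoMetric n (F x) (F x) +
      s * (2 * pseudoMetric n (F x) (F T)) + s * s * pseudoMetric n (F T) (F T)) := by fun_prop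
    have h4 := (this.tendsto 0).mono_left (nhdsWithin_le_nhds (s := Set.Ioi 0))
    simpa using h4
  exact le_of_tendsto h3 (by filter_upwards [self_mem_nhdsWithin] with s hs using h1 s hs)

/-- The line `x + s • t` meets the null cone at parameters `s₁ < 0 < s₂` with product `g(x,x) /
g(t,t)`. Weighting the inequalities there by `s₂` and `-s₁` eliminates the mixed term `g(F x, F t)`.
-/
theorem pseudoMetric_mul_le_of_spacelike_timelike (hn : 2 ≤ n)
    (hF : ∀ t, pseudoMetric n t t < 0 → pseudoMetric n (F t) (F t) ≤ 0) {x t : Fin n → ℝ}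
    (hx : 0 < pseudoMetric n x x) (ht : pseudoMetric n t t < 0) :
    pseudoMetric n x x * pseudoMetric n (F t) (F t) ≤
      pseudoMetric n (F x) (F x) * pseudoMetric n t t := by
  set A := pseudoMetric n x x
  set B := pseudoMetric n x t with hB
  set C := pseudoMetric n t t
  set P := pseudoMetric n (F x) (F x)
  set Q := pseudoMetric n (F x) (F t) with hQ
  set R := pseudoMetric n (F t) (F t)
  have hroot : ∀ s : ℝ, A + 2 * B * s + C * (s * s) = 0 → P + 2 * Q * s + R * (s * s) ≤ 0 := by
    intro s hs
    have h1 := pseudoMetric_nonpos_of_null hn hF (x := x + s • t) (by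
      simp only [map_add, map_smul, LinearMap.add_apply, LinearMap.smul_apply, smul_eq_mul,
        pseudoMetric_comm t x]
      linarith)
    simp only [map_add, map_smul, LinearMap.add_apply, LinearMap.smul_apply, smul_eq_mul,
      pseudoMetric_comm (F t) (F x)] at h1
    linarith
  have hAC : 0 < A * -C := mul_pos hx (neg_pos.2 ht)
  set D := Real.sqrt (B * B + A * -C)
  have hD : D * D = B * B + A * -C := Real.mul_self_sqrt (by nlinarith [mul_self_nonneg B])
  have hD0 : 0 ≤ D := Real.sqrt_nonneg _
  have hBD : |B| < D := abs_lt_of_sq_lt_sq (by nlinarith) hD0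
  obtain ⟨hBD1, hBD2⟩ := abs_lt.1 hBD
  have hC : C ≠ 0 := ht.ne
  have h1 := hroot ((-B + D) / C) (by field_simp; linear_combination hD)
  have h2 := hroot ((-B - D) / C) (by field_simp; linear_combination hD)
  have hs1 : (-B + D) / C < 0 := div_neg_of_pos_of_neg (by linarith) ht
  have hs2 : 0 < (-B - D) / C := div_pos_of_neg_of_neg (by linarith) ht
  have hprod : (-B + D) / C * ((-B - D) / C) = A / C := by
    field_simp
    linear_combination -hD
  generalize (-B + D) / C = s₁ at *
  generalize (-B - D) / C = s₂ at *
  have h3 : (s₂ - s₁) * (P - R * (A / C)) ≤ 0 := by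
    rw [← hprod]
    nlinarith [mul_nonneg hs2.le (neg_nonneg.2 h1), mul_nonneg (neg_nonneg.2 hs1.le)
      (neg_nonneg.2 h2)]
  have h4 : P - R * (A / C) ≤ 0 := by
    by_contra! h
    nlinarith [mul_pos (show 0 < s₂ - s₁ by linarith) h]
  have h5 : R * (A / C) * C = A * R := by field_simp
  nlinarith [mul_nonneg (neg_nonneg.2 h4) (neg_nonneg.2 ht.le)]

/-- The S-lemma for the metric and its pullback, with the optimal constant. -/
theorem exists_optimal_slope (hn : 2 ≤ n)
    (hF : ∀ t, pseudoMetric n t t < 0 → pseudoMetric n (F t) (F t) ≤ 0) :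
    ∃ c : ℝ, 0 ≤ c ∧ (∀ x, pseudoMetric n (F x) (F x) ≤ c * pseudoMetric n x x) ∧
      ∃ k, k ≠ 0 ∧ pseudoMetric n k k ≤ 0 ∧
        pseudoMetric n (F k) (F k) = c * pseudoMetric n k k := by
  obtain ⟨T, hT⟩ := exists_isTimelikeVec hn
  -- The optimal constant is the infimum of the ratio over timelike vectors; ratios at spacelike
  -- vectors are lower bounds of `S`.
  set S : Set ℝ := {r | ∃ t, pseudoMetric n t t < 0 ∧
    r = pseudoMetric n (F t) (F t) / pseudoMetric n t t} with hS
  have hSne : S.Nonempty := ⟨_, T, hT, rfl⟩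
  have hS0 : ∀ r ∈ S, 0 ≤ r := by
    rintro r ⟨t, ht, rfl⟩
    exact div_nonneg_of_nonpos (hF t ht) ht.le
  have hbdd : BddBelow S := ⟨0, hS0⟩
  set c := sInf S
  have hle : ∀ x, pseudoMetric n (F x) (F x) ≤ c * pseudoMetric n x x := by
    intro x
    obtain h | h | h := lt_trichotomy (pseudoMetric n x x) 0
    · exact (le_div_iff_of_neg h).1 (csInf_le hbdd ⟨x, h, rfl⟩)
    · rw [h, mul_zero]
      exact pseudoMetric_nonpos_of_null hn hF h
    · rw [← div_le_iff₀ h]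
      refine le_csInf hSne ?_
      rintro r ⟨t, ht, rfl⟩
      rw [le_div_iff_of_neg ht, div_mul_eq_mul_div, le_div_iff₀ h, mul_comm]
      exact pseudoMetric_mul_le_of_spacelike_timelike hn hF h ht
  refine ⟨c, le_csInf hSne hS0, hle, ?_⟩
  by_contra! hne
  have hcont : Continuous fun x : Fin n → ℝ => pseudoMetric n x x := by
    simp only [pseudoMetric_apply]
    fun_prop
  have hcontF : Continuous fun x : Fin n → ℝ => pseudoMetric n (F x) (F x) :=
    hcont.comp F.continuous_of_finiteDimensional
  have hcompact : IsCompact (Metric.sphere (0 : Fin n → ℝ) 1 ∩ {x | pseudoMetric n x x ≤ 0}) :=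
    (isCompact_sphere _ _).inter_right (isClosed_le hcont continuous_const)
  have hscale : ∀ t : Fin n → ℝ, pseudoMetric n t t < 0 →
      ‖t‖⁻¹ • t ∈ Metric.sphere (0 : Fin n → ℝ) 1 ∩ {x | pseudoMetric n x x ≤ 0} := by
    intro t ht
    have ht0 : t ≠ 0 := by
      rintro rfl
      simp at ht
    refine ⟨by simp [norm_smul, ht0], ?_⟩
    simp only [Set.mem_ofPred_eq, map_smul, LinearMap.smul_apply, smul_eq_mul]
    nlinarith [mul_nonneg (mul_self_nonneg ‖t‖⁻¹) (neg_nonneg.2 ht.le)]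
  -- If equality never held, the gap would have a positive minimum `δ` relative to `1 - g(x,x)`, and
  -- every ratio in `S` would be at least `c + δ`. The denominator is at least 1 here, null vectors
  -- included.
  obtain ⟨x₀, hx₀, hmin⟩ := hcompact.exists_isMinOn ⟨_, hscale T hT⟩
    (f := fun x => (c * pseudoMetric n x x - pseudoMetric n (F x) (F x)) /
      (1 - pseudoMetric n x x)) (by
      refine ContinuousOn.div (by fun_prop) (by fun_prop) ?_
      rintro x ⟨-, hx⟩
      rw [Set.mem_ofPred_eq] at hx
      linarith)
  set δ := (c * pseudoMetric n x₀ x₀ - pseudoMetric n (F x₀) (F x₀)) /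
    (1 - pseudoMetric n x₀ x₀)
  have hδ : 0 < δ := by
    have hx₀' : pseudoMetric n x₀ x₀ ≤ 0 := hx₀.2
    have h0 : x₀ ≠ 0 := by
      rintro rfl
      simpa using hx₀.1
    refine div_pos ?_ (by linarith)
    exact sub_pos.2 (lt_of_le_of_ne (hle x₀) (hne x₀ h0 hx₀'))
  have hδle : c + δ ≤ c := by
    refine le_csInf hSne ?_
    rintro r ⟨t, ht, rfl⟩
    rw [le_div_iff_of_neg ht]
    have h1 := hmin (hscale t ht)
    have h2 := (hscale t ht).2
    rw [Set.mem_ofPred_eq] at h1 h2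
    rw [le_div_iff₀ (by linarith)] at h1
    have ht0 : 0 < ‖t‖⁻¹ * ‖t‖⁻¹ := by
      refine mul_self_pos.2 (inv_ne_zero (norm_ne_zero_iff.2 ?_))
      rintro rfl
      simp at ht
    simp only [map_smul, LinearMap.smul_apply, smul_eq_mul] at h1
    generalize ‖t‖⁻¹ = r at *
    have h3 : r * r * (pseudoMetric n (F t) (F t) - (c + δ) * pseudoMetric n t t) ≤ 0 := by
      linarith
    by_contra! h4
    nlinarith [mul_pos ht0 (sub_pos.2 h4)]
  linarith

end Slope

/-! ### Slope zero: decomposable forms. -/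

theorem wedgeCovec_linear_combination {n : ℕ} (u v : Fin n → ℝ) (a b a' b' : ℝ) :
    wedgeCovec (pseudoMetric n (a • u + b • v)) (pseudoMetric n (a' • u + b' • v)) =
      (a * b' - b * a') • wedgeCovec (pseudoMetric n u) (pseudoMetric n v) :=
  LinearMap.ext₂ fun x y => by
    simp only [LinearMap.smul_apply, wedgeCovec_apply, map_add, map_smul, LinearMap.add_apply,
      smul_eq_mul]
    ring

/-- A nonzero form whose image is nonpositive is the wedge product of two vectors of the image. -/
theorem exists_eq_wedge_of_nonpos {n : ℕ} {ω : BilinForm ℝ (Fin n → ℝ)} (hω : ω.IsAlt)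
    (hω0 : ω ≠ 0) (hneg : ∀ x, pseudoMetric n (dualEndo ω x) (dualEndo ω x) ≤ 0) :
    ∃ x y, ω = wedgeCovec (pseudoMetric n (dualEndo ω x)) (pseudoMetric n (dualEndo ω y)) ∧
      LinearIndependent ℝ ![dualEndo ω x, dualEndo ω y] := by
  obtain ⟨x, y, hxy⟩ : ∃ x y, ω x y = 1 := by
    obtain ⟨x, hx⟩ : ∃ x, ω x ≠ 0 := by
      by_contra! h
      exact hω0 (LinearMap.ext h)
    obtain ⟨y, hy⟩ : ∃ y, ω x y ≠ 0 := by
      by_contra! h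
      exact hx (LinearMap.ext h)
    exact ⟨x, (ω x y)⁻¹ • y, by rw [map_smul, smul_eq_mul, inv_mul_cancel₀ hy]⟩
  set u := dualEndo ω x with hu
  set v := dualEndo ω y with hv
  have huy : pseudoMetric n u y = 1 := by rw [hu, pseudoMetric_dualEndo, hxy]
  have hvx : pseudoMetric n v x = -1 := by rw [hv, pseudoMetric_dualEndo, ← hω.neg_eq, hxy]
  have hux : pseudoMetric n u x = 0 := dualEndo_self hω x
  have hvy : pseudoMetric n v y = 0 := dualEndo_self hω y
  have hli : LinearIndependent ℝ ![u, v] := by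
    rw [LinearIndependent.pair_iff]
    intro a b hab
    have h1 := congrArg (fun z => pseudoMetric n z y) hab
    have h2 := congrArg (fun z => pseudoMetric n z x) hab
    simp only [map_add, map_smul, LinearMap.add_apply, LinearMap.smul_apply, smul_eq_mul, huy, hvx,
      hux, hvy, map_zero, LinearMap.zero_apply] at h1 h2
    constructor <;> linarith
  have hspan : Submodule.span ℝ {u, v} = LinearMap.range (dualEndo ω) := by
    refine Submodule.eq_of_le_of_finrank_le ?_ ?_
    · rw [Submodule.span_le]
      rintro z (rfl | rfl)
      exacts [⟨x, rfl⟩, ⟨y, rfl⟩]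
    · rw [finrank_span_pair_of_linearIndependent hli]
      refine finrank_le_two_of_nonpos _ ?_
      rintro _ ⟨z, rfl⟩
      exact hneg z
  refine ⟨x, y, LinearMap.ext₂ fun z w => ?_, hli⟩
  have hz : dualEndo ω z ∈ Submodule.span ℝ {u, v} := by
    rw [hspan]
    exact ⟨z, rfl⟩
  obtain ⟨a, b, hab⟩ := Submodule.mem_span_pair.1 hz
  have h1 := dualEndo_skew hω z y
  have h2 := dualEndo_skew hω z x
  rw [← hab, pseudoMetric_comm z] at h1 h2
  simp only [map_add, map_smul, LinearMap.add_apply, LinearMap.smul_apply, smul_eq_mul, huy, hvx,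
    hux, hvy] at h1 h2
  rw [← pseudoMetric_dualEndo, ← hab, wedgeCovec_apply]
  simp only [map_add, map_smul, LinearMap.add_apply, LinearMap.smul_apply, smul_eq_mul]
  rw [← hu] at h2
  rw [← hv] at h1
  rw [show a = -pseudoMetric n v z by linarith, show b = pseudoMetric n u z by linarith]
  ring

/-- `l` is completed by `m` with a unimodular change of basis, which keeps the wedge.
Semidefiniteness makes the null `l` orthogonal to `m`, and the type depends on whether `m` is null
or timelike. -/
theorem isTypeIa_or_isTypeIb_of_null_mem {n : ℕ} {u v l : Fin n → ℝ}
    (huv : LinearIndependent ℝ ![u, v])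
    (hneg : ∀ a b : ℝ, pseudoMetric n (a • u + b • v) (a • u + b • v) ≤ 0) {a b : ℝ}
    (hab : a • u + b • v = l) (hl : l ≠ 0) (hll : pseudoMetric n l l = 0) :
    IsTypeIa (wedgeCovec (pseudoMetric n u) (pseudoMetric n v)) ∨
      IsTypeIb (wedgeCovec (pseudoMetric n u) (pseudoMetric n v)) := by
  obtain ⟨a', b', hdet⟩ : ∃ a' b' : ℝ, a * b' - b * a' = 1 := by
    by_cases ha : a = 0
    · by_cases hb : b = 0
      · rw [ha, hb, zero_smul, zero_smul, add_zero] at hab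
        exact absurd hab.symm hl
      · exact ⟨-b⁻¹, 0, by field_simp; ring⟩
    · exact ⟨0, a⁻¹, by field_simp; ring⟩
  set m := a' • u + b' • v with hm
  have hω : wedgeCovec (pseudoMetric n l) (pseudoMetric n m) =
      wedgeCovec (pseudoMetric n u) (pseudoMetric n v) := by
    rw [← hab, hm, wedgeCovec_linear_combination, hdet, one_smul]
  have hlm : pseudoMetric n l m = 0 := by
    have : 2 * pseudoMetric n l m = 0 :=
      eq_zero_of_forall_mul_add_nonpos (c := pseudoMetric n m m) fun s => by
        have h1 := hneg (s * a + a') (s * b + b')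
        rw [show (s * a + a') • u + (s * b + b') • v = s • l + m by rw [← hab, hm]; module] at h1
        simp only [map_add, map_smul, LinearMap.add_apply, LinearMap.smul_apply, smul_eq_mul, hll,
          pseudoMetric_comm m l] at h1
        linarith
    linarith
  rw [← hω]
  obtain hmm | hmm := (hneg a' b').lt_or_eq
  · exact Or.inr ⟨l, m, ⟨hl, hll⟩, hmm, hlm, rfl⟩
  · refine Or.inl (isTypeIa_wedge ?_ hll hlm hmm)
    rw [LinearIndependent.pair_iff]
    intro s t hst
    have h1 : (s * a + t * a') • u + (s * b + t * b') • v = 0 := by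
      rw [← hst, ← hab, hm]
      module
    obtain ⟨h2, h3⟩ := LinearIndependent.pair_iff.1 huv _ _ h1
    constructor
    · linear_combination b' * h2 - a' * h3 - s * hdet
    · linear_combination a * h3 - b * h2 - t * hdet

/-- The image plane contains a null vector: `F k` if it is nonzero. Otherwise `k` is orthogonal to
the image and nonspacelike, hence in the image plane and null. -/
theorem isTypeIa_or_isTypeIb_of_nonpos {n : ℕ} {ω : BilinForm ℝ (Fin n → ℝ)} (hω : ω.IsAlt)
    (hω0 : ω ≠ 0) (hneg : ∀ x, pseudoMetric n (dualEndo ω x) (dualEndo ω x) ≤ 0)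
    {k : Fin n → ℝ} (hk : k ≠ 0) (hkk : pseudoMetric n k k ≤ 0)
    (hFk : pseudoMetric n (dualEndo ω k) (dualEndo ω k) = 0) : IsTypeIa ω ∨ IsTypeIb ω := by
  obtain ⟨x, y, hxy, hli⟩ := exists_eq_wedge_of_nonpos hω hω0 hneg
  have hplane : ∀ a b : ℝ, pseudoMetric n (a • dualEndo ω x + b • dualEndo ω y)
      (a • dualEndo ω x + b • dualEndo ω y) ≤ 0 := fun a b => by
    rw [← map_smul, ← map_smul, ← map_add]
    exact hneg _
  have hFk' : dualEndo ω k = pseudoMetric n (dualEndo ω x) k • dualEndo ω y -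
      pseudoMetric n (dualEndo ω y) k • dualEndo ω x := by
    conv_lhs => rw [hxy]
    rw [dualEndo_wedge]
  rw [hxy]
  by_cases h0 : dualEndo ω k = 0
  · have hx : pseudoMetric n (dualEndo ω x) k = 0 := by
      rw [dualEndo_skew hω, h0, map_zero, neg_zero]
    have hy : pseudoMetric n (dualEndo ω y) k = 0 := by
      rw [dualEndo_skew hω, h0, map_zero, neg_zero]
    obtain ⟨a, b, hab⟩ := exists_eq_of_nonpos_plane hli hplane hx hy hkk
    refine isTypeIa_or_isTypeIb_of_null_mem hli hplane hab hk ?_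
    have h1 : pseudoMetric n (a • dualEndo ω x + b • dualEndo ω y) k = 0 := by
      simp only [map_add, map_smul, LinearMap.add_apply, LinearMap.smul_apply, hx, hy, smul_zero,
        add_zero]
    rwa [hab] at h1
  · exact isTypeIa_or_isTypeIb_of_null_mem hli hplane (a := -pseudoMetric n (dualEndo ω y) k)
      (b := pseudoMetric n (dualEndo ω x) k) (by rw [hFk']; module) h0 hFk

/-! ### Positive slope: replacing the form by one of a listed type. -/

section Reduction

variable {n : ℕ} {ω : BilinForm ℝ (Fin n → ℝ)} {c : ℝ}

/-- The kernel of `F² + c`, where `F` is the endomorphism dual to `ω`. -/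
noncomputable def slopeKernel (ω : BilinForm ℝ (Fin n → ℝ)) (c : ℝ) : Submodule ℝ (Fin n → ℝ) :=
  LinearMap.ker (dualEndo ω * dualEndo ω + c • (1 : Module.End ℝ (Fin n → ℝ)))

theorem mem_slopeKernel {x : Fin n → ℝ} :
    x ∈ slopeKernel ω c ↔ dualEndo ω (dualEndo ω x) = -(c • x) := by
  rw [slopeKernel, LinearMap.mem_ker, LinearMap.add_apply, Module.End.mul_apply,
    LinearMap.smul_apply, Module.End.one_apply, add_eq_zero_iff_eq_neg]

theorem dualEndo_mem_slopeKernel {x : Fin n → ℝ} (hx : x ∈ slopeKernel ω c) :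
    dualEndo ω x ∈ slopeKernel ω c := by
  rw [mem_slopeKernel] at hx ⊢
  rw [hx, map_neg, map_smul]

theorem pseudoMetric_dualEndo_slopeKernel (hω : ω.IsAlt) {x : Fin n → ℝ}
    (hx : x ∈ slopeKernel ω c) :
    pseudoMetric n (dualEndo ω x) (dualEndo ω x) = c * pseudoMetric n x x := by
  rw [dualEndo_skew hω, mem_slopeKernel.1 hx, map_neg, map_smul, neg_neg, smul_eq_mul]

/-- `g((F² + c) x, x) = c g(x,x) - g(Fx, Fx)` is nonnegative and vanishes at `k`, so `k` lies in its
radical. -/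
theorem mem_slopeKernel_of_eq (hω : ω.IsAlt)
    (hle : ∀ x, pseudoMetric n (dualEndo ω x) (dualEndo ω x) ≤ c * pseudoMetric n x x)
    {k : Fin n → ℝ}
    (hk : pseudoMetric n (dualEndo ω k) (dualEndo ω k) = c * pseudoMetric n k k) :
    k ∈ slopeKernel ω c := by
  have h1 : ∀ x y, pseudoMetric n ((dualEndo ω * dualEndo ω +
      c • (1 : Module.End ℝ (Fin n → ℝ))) x) y =
      -pseudoMetric n (dualEndo ω x) (dualEndo ω y) + c * pseudoMetric n x y := fun x y => by
    simp only [LinearMap.add_apply, Module.End.mul_apply, LinearMap.smul_apply,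
      Module.End.one_apply, map_add, map_smul, smul_eq_mul, dualEndo_skew hω (dualEndo ω x)]
  refine eq_zero_of_semidefinite (fun x y => ?_) (fun x => ?_) ?_
  · rw [pseudoMetric_comm x, h1, h1, pseudoMetric_comm x, pseudoMetric_comm (dualEndo ω x)]
  · rw [h1]
    linarith [hle x]
  · rw [h1, hk]
    ring

/-- `k` and `F k` span a negative definite plane in `K`, so `K^⊥` is positive definite. `F / √c` on
`K`, extended by zero, is the partial complex structure; it commutes with the stabilizer because `K`
is defined by `F` alone. -/
theorem exists_isPartialKaehler_of_timelike (hω : ω.IsAlt) (hc : 0 < c) {k : Fin n → ℝ}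
    (hk : k ∈ slopeKernel ω c) (hkk : pseudoMetric n k k < 0) :
    ∃ η : BilinForm ℝ (Fin n → ℝ), η.IsAlt ∧
      (∃ E : Submodule ℝ (Fin n → ℝ), IsPartialKaehler η E) ∧
      pseudoO n ⊓ formStabilizer ω ≤ formStabilizer η := by
  set F := dualEndo ω
  set K := slopeKernel ω c
  set E := (pseudoMetric n).orthogonal K
  have hFk := dualEndo_mem_slopeKernel hk
  have hFkk := pseudoMetric_dualEndo_slopeKernel hω hk
  have hkFk : pseudoMetric n k (F k) = 0 := by rw [pseudoMetric_comm, dualEndo_self hω]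
  have hFkk' : pseudoMetric n (F k) (F k) < 0 := by
    rw [hFkk]
    exact mul_neg_of_pos_of_neg hc hkk
  have hpos : ∀ x ∈ E, x ≠ 0 → 0 < pseudoMetric n x x := by
    intro x hx hx0
    by_contra! hneg
    have h1 : pseudoMetric n k x = 0 := hx k hk
    have h2 : pseudoMetric n (F k) x = 0 := hx _ hFk
    obtain ⟨a, b, rfl⟩ := exists_eq_of_nonpos_plane (linearIndependent_null_nonnull
      (fun h => by simp [h] at hkk) hFkk'.ne hkFk) (fun a b => by
        simp only [map_add, map_smul, LinearMap.add_apply, LinearMap.smul_apply, smul_eq_mul,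
          hkFk, pseudoMetric_comm (F k) k]
        nlinarith [mul_nonneg (mul_self_nonneg a) (neg_nonneg.2 hkk.le),
          mul_nonneg (mul_self_nonneg b) (neg_nonneg.2 hFkk'.le)]) h1 h2 hneg
    simp only [map_add, map_smul, smul_eq_mul, hkFk, pseudoMetric_comm (F k) k, mul_zero, add_zero,
      zero_add, mul_eq_zero, hkk.ne, hFkk'.ne, or_false] at h1 h2
    exact hx0 (by rw [h1, h2, zero_smul, zero_smul, add_zero])
  have hEK : (pseudoMetric n).orthogonal E = K :=
    LinearMap.BilinForm.orthogonal_orthogonal (pseudoMetric_nondegenerate n)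
      (pseudoMetric_isRefl n) K
  have hcompl : IsCompl K E := by
    have := isCompl_orthogonal_of_pos hpos
    rw [hEK] at this
    exact this.symm
  set d := (Real.sqrt c)⁻¹
  have hd : d * d * c = 1 := by
    rw [← mul_inv, Real.mul_self_sqrt hc.le, inv_mul_cancel₀ hc.ne']
  set J : Module.End ℝ (Fin n → ℝ) := d • (F * K.projection E hcompl)
  have hJE : ∀ x ∈ E, J x = 0 := fun x hx => by
    simp only [J, LinearMap.smul_apply, Module.End.mul_apply]
    rw [(Submodule.projection_apply_eq_zero_iff hcompl).2 hx, map_zero, smul_zero]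
  have hJK : ∀ x ∈ K, J x = d • F x := fun x hx => by
    simp only [J, LinearMap.smul_apply, Module.End.mul_apply]
    rw [Submodule.projection_apply_of_mem_left hcompl hx]
  have hdecomp : ∀ x : Fin n → ℝ, ∃ p ∈ K, ∃ q ∈ E, p + q = x := fun x =>
    Submodule.mem_sup.1 (hcompl.sup_eq_top ▸ Submodule.mem_top)
  have hskew : ∀ x y, pseudoMetric n (J x) y = -pseudoMetric n x (J y) := by
    intro x y
    obtain ⟨p, hp, q, hq, rfl⟩ := hdecomp x
    obtain ⟨p', hp', q', hq', rfl⟩ := hdecomp y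
    have h1 : pseudoMetric n (F p) q' = 0 := hq' _ (dualEndo_mem_slopeKernel hp)
    have h2 : pseudoMetric n (F p') q = 0 := hq _ (dualEndo_mem_slopeKernel hp')
    simp only [map_add, hJE q hq, hJE q' hq', hJK p hp, hJK p' hp', map_smul, LinearMap.add_apply,
      LinearMap.smul_apply, smul_eq_mul, map_zero, LinearMap.zero_apply, h1,
      pseudoMetric_comm q (F p'), h2, F, dualEndo_skew hω p p']
    ring
  have hJ : IsPartialComplexStructure J E := by
    refine ⟨hpos, hJE, fun x hx => ?_, hskew⟩
    rw [hEK] at hx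
    have h1 : F (F x) = -(c • x) := mem_slopeKernel.1 hx
    rw [hJK x hx, map_smul, hJK _ (dualEndo_mem_slopeKernel hx), h1, smul_smul, smul_neg,
      smul_smul, hd, one_smul]
  have hF : ∀ x, dualEndo ((pseudoMetric n) ∘ₗ J) x = J x := fun x => eq_dualEndo fun y => rfl
  refine ⟨(pseudoMetric n) ∘ₗ J, fun x => ?_, ⟨E, hJ.isPartialKaehler one_ne_zero
    fun x => by rw [hF, one_smul]⟩, ?_⟩
  · rw [LinearMap.comp_apply, pseudoMetric_comm, hJ.self_orthogonal]
  · rintro h ⟨hO, hst⟩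
    have hh := (mem_formStabilizer_iff_dualEndo hO).1 hst
    refine (mem_formStabilizer_iff_dualEndo hO).2 fun x => ?_
    have hhK : ∀ z, h z ∈ K ↔ z ∈ K := fun z => by
      rw [mem_slopeKernel, mem_slopeKernel, hh, hh, ← map_smul, ← map_neg, h.injective.eq_iff]
    have hhE : ∀ z ∈ E, h z ∈ E := by
      intro z hz w hw
      obtain ⟨w, rfl⟩ := h.surjective w
      rw [hO]
      exact hz w ((hhK w).1 hw)
    obtain ⟨p, hp, q, hq, rfl⟩ := hdecomp x
    rw [hF, hF, map_add, map_add, map_add, hJE q hq, hJE _ (hhE q hq), hJK p hp,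
      hJK _ ((hhK p).2 hp), add_zero, add_zero, map_smul, hh]

/-- Since `g ≥ 0` on `K`, the null `k` is orthogonal to `K`, so `k` and `F k` span a totally null
plane. The stabilizer preserves this plane, and semidefiniteness of `F² + c` shows that it acts
there with determinant one, fixing `k ∧ F k`. -/
theorem exists_isTypeIa_of_null (hω : ω.IsAlt) (hc : 0 < c)
    (hle : ∀ x, pseudoMetric n (dualEndo ω x) (dualEndo ω x) ≤ c * pseudoMetric n x x)
    (hpos : ∀ x ∈ slopeKernel ω c, 0 ≤ pseudoMetric n x x) {k : Fin n → ℝ}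
    (hk : k ∈ slopeKernel ω c) (hk0 : k ≠ 0) (hkk : pseudoMetric n k k = 0) :
    ∃ η : BilinForm ℝ (Fin n → ℝ), η.IsAlt ∧ IsTypeIa η ∧
      pseudoO n ⊓ formStabilizer ω ≤ formStabilizer η := by
  set F := dualEndo ω
  set A : Module.End ℝ (Fin n → ℝ) := F * F + c • (1 : Module.End ℝ (Fin n → ℝ)) with hA
  have hskew : ∀ x y, pseudoMetric n (F x) y = -pseudoMetric n x (F y) := dualEndo_skew hω
  have hA_apply : ∀ x, A x = F (F x) + c • x := fun x => rfl
  have hA_symm : ∀ x y, pseudoMetric n (A x) y = pseudoMetric n x (A y) := fun x y => by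
    rw [hA_apply, hA_apply, map_add, map_add, LinearMap.add_apply, hskew (F x), hskew x, neg_neg,
      map_smul, map_smul, LinearMap.smul_apply]
  have hperp : ∀ z ∈ slopeKernel ω c, pseudoMetric n k z = 0 := by
    intro z hz
    have h1 : 2 * pseudoMetric n k z = 0 :=
      eq_zero_of_forall_mul_add_nonpos (c := -pseudoMetric n z z) fun s => by
        have h2 := hpos (z + (-s) • k) (add_mem hz (Submodule.smul_mem _ _ hk))
        simp only [map_add, map_smul, LinearMap.add_apply, LinearMap.smul_apply, smul_eq_mul, hkk,
          pseudoMetric_comm z k] at h2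
        linarith
    linarith
  -- `k` is orthogonal to `ker A`, and `A` is self-adjoint, so `k` is in its range. This `y` detects
  -- the determinant: `g(k, y) = g(A y, y) ≠ 0`.
  obtain ⟨y, hy⟩ : ∃ y, A y = k := by
    change k ∈ LinearMap.range A
    rw [← LinearMap.BilinForm.orthogonal_orthogonal (pseudoMetric_nondegenerate n)
      (pseudoMetric_isRefl n) (LinearMap.range A)]
    intro z hz
    rw [pseudoMetric_comm]
    refine hperp z ?_
    refine eq_zero_of_pseudoMetric fun w => ?_
    change pseudoMetric n (A z) w = 0
    rw [pseudoMetric_comm, ← hA_symm w z]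
    exact hz _ ⟨w, rfl⟩
  have hFF : F (F k) = -(c • k) := mem_slopeKernel.1 hk
  have hkFk : pseudoMetric n k (F k) = 0 := hperp _ (dualEndo_mem_slopeKernel hk)
  have hFkk : pseudoMetric n (F k) (F k) = 0 := by
    rw [pseudoMetric_dualEndo_slopeKernel hω hk, hkk, mul_zero]
  have hpos' : ∀ a b : ℝ, a * a + c * (b * b) = 0 → a = 0 ∧ b = 0 := fun a b h => by
    have h1 := mul_nonneg hc.le (mul_self_nonneg b)
    have h2 := mul_self_nonneg a
    refine ⟨mul_self_eq_zero.1 (by linarith), ?_⟩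
    have h3 : c * (b * b) = 0 := by linarith
    exact mul_self_eq_zero.1 ((mul_eq_zero.1 h3).resolve_left hc.ne')
  have hli : LinearIndependent ℝ ![k, F k] := by
    rw [LinearIndependent.pair_iff]
    intro a b hab
    have h1 := congrArg F hab
    simp only [map_add, map_smul, hFF, map_zero] at h1
    have h2 : (a * a + c * (b * b)) • k = 0 := by
      linear_combination (norm := module) a • hab - b • h1
    exact hpos' a b ((smul_eq_zero.1 h2).resolve_right hk0)
  refine ⟨_, wedgeCovec_isAlt _ _, isTypeIa_wedge hli hkk hkFk hFkk, ?_⟩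
  rintro h ⟨hO, hst⟩
  have hh : ∀ x, F (h x) = h (F x) := (mem_formStabilizer_iff_dualEndo hO).1 hst
  have hhk : h k ∈ slopeKernel ω c := by
    rw [mem_slopeKernel]
    change F (F (h k)) = _
    rw [hh, hh, hFF, map_neg, map_smul]
  obtain ⟨a, b, hab⟩ := exists_eq_of_nonpos_plane (x := h k) hli (fun a b => by
      simp only [map_add, map_smul, LinearMap.add_apply, LinearMap.smul_apply, smul_eq_mul, hkk,
        hkFk, hFkk, pseudoMetric_comm (F k) k, mul_zero, add_zero, le_refl])
    (hperp _ hhk) (by rw [hskew, hperp _ (dualEndo_mem_slopeKernel hhk), neg_zero])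
    (by rw [hO, hkk])
  have hq : pseudoMetric n k y ≠ 0 := by
    intro h0
    rw [← hy] at h0
    refine hk0 ?_
    rw [← hy]
    refine eq_zero_of_semidefinite hA_symm (fun x => ?_) h0
    have h1 := hle x
    rw [hA_apply, map_add, LinearMap.add_apply, hskew, map_smul, LinearMap.smul_apply, smul_eq_mul]
    linarith
  -- The left side is the determinant of `h` on the plane. Invariance of `g(k, y)`, with `h k = A (a
  -- • y + b • F y)` and `A` moved to `h y`, gives this factor; the cross terms cancel by skewness.
  have hnorm : a * a + c * (b * b) = 1 := by
    have h1 : A (h y) = a • k + b • F k := by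
      rw [hab, ← hy, hA_apply, hA_apply, hh, hh, map_add, map_smul]
    have h2 : A (a • y + b • F y) = a • k + b • F k := by
      simp only [← hy, hA_apply, map_add, map_smul]
      module
    have h3 := hO k y
    rw [← hab, ← h2, hA_symm, h1] at h3
    have h4 := hskew y (F k)
    rw [hFF, map_neg, map_smul, neg_neg, smul_eq_mul, pseudoMetric_comm y k] at h4
    have h5 := hskew y k
    simp only [map_add, map_smul, LinearMap.add_apply, LinearMap.smul_apply, smul_eq_mul, h4, h5,
      pseudoMetric_comm y k] at h3
    exact mul_right_cancel₀ hq (by linear_combination h3)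
  intro x z
  have hFab : h (F k) = a • F k - (c * b) • k := by
    rw [← hh, ← hab, map_add, map_smul, map_smul, hFF]
    module
  have h1 := hO k x
  have h2 := hO k z
  have h3 := hO (F k) x
  have h4 := hO (F k) z
  simp only [← hab, hFab, map_add, map_sub, map_smul, LinearMap.add_apply, LinearMap.sub_apply,
    LinearMap.smul_apply, smul_eq_mul] at h1 h2 h3 h4
  rw [wedgeCovec_apply, wedgeCovec_apply, ← h1, ← h2, ← h3, ← h4]
  linear_combination -(pseudoMetric n k (h x) * pseudoMetric n (F k) (h z) -
    pseudoMetric n (F k) (h x) * pseudoMetric n k (h z)) * hnorm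

end Reduction

/-! ### Assembly of the classification. -/

/-- The stabilizer of a form with causal contractions is contained in that of a form of one of the
four types. -/
theorem exists_type_of_hasCausalContractions {n : ℕ} (hn : 2 ≤ n) {ω : BilinForm ℝ (Fin n → ℝ)}
    (hω : ω.IsAlt) (hω0 : ω ≠ 0) (hcausal : HasCausalContractions ω) :
    ∃ η : BilinForm ℝ (Fin n → ℝ), η.IsAlt ∧
      (IsTypeIa η ∨ IsTypeIb η ∨ ∃ E, IsPartialKaehler η E) ∧
      pseudoO n ⊓ formStabilizer ω ≤ formStabilizer η := by
  obtain ⟨c, hc, hle, k, hk0, hkk, hk⟩ :=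
    exists_optimal_slope (F := dualEndo ω) hn fun _ ht => hcausal.dualEndo_nonpos ht
  obtain rfl | hc := hc.eq_or_lt
  · refine ⟨ω, hω, ?_, inf_le_right⟩
    simp only [zero_mul] at hle hk
    obtain h | h := isTypeIa_or_isTypeIb_of_nonpos hω hω0 hle hk0 hkk hk
    exacts [Or.inl h, Or.inr (Or.inl h)]
  have hkK := mem_slopeKernel_of_eq hω hle hk
  by_cases hpos : ∀ x ∈ slopeKernel ω c, 0 ≤ pseudoMetric n x x
  · obtain ⟨η, hη, h, hstab⟩ :=
      exists_isTypeIa_of_null hω hc hle hpos hkK hk0 (le_antisymm hkk (hpos k hkK))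
    exact ⟨η, hη, Or.inl h, hstab⟩
  · push Not at hpos
    obtain ⟨t, htK, ht⟩ := hpos
    obtain ⟨η, hη, h, hstab⟩ := exists_isPartialKaehler_of_timelike hω hc htK ht
    exact ⟨η, hη, Or.inr (Or.inr h), hstab⟩

theorem IsTypeIa.smul {n : ℕ} {ω : BilinForm ℝ (Fin n → ℝ)} (h : IsTypeIa ω) {c : ℝ}
    (hc : c ≠ 0) : IsTypeIa (c • ω) := by
  obtain ⟨l₁, l₂, hli, hnull, rfl⟩ := h
  obtain ⟨h11, h22, h12⟩ := null_plane_products hnull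
  have h1 := wedgeCovec_linear_combination l₁ l₂ c 0 0 1
  simp only [zero_smul, add_zero, one_smul, zero_add, mul_one, mul_zero, sub_zero] at h1
  rw [← h1]
  refine isTypeIa_wedge ?_ (by simp [h11]) (by simp [h12]) h22
  rw [LinearIndependent.pair_iff] at hli ⊢
  intro a b hab
  rw [smul_smul] at hab
  obtain ⟨h2, h3⟩ := hli _ _ hab
  exact ⟨(mul_eq_zero.1 h2).resolve_right hc, h3⟩

theorem IsTypeIb.smul {n : ℕ} {ω : BilinForm ℝ (Fin n → ℝ)} (h : IsTypeIb ω) {c : ℝ}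
    (hc : c ≠ 0) : IsTypeIb (c • ω) := by
  obtain ⟨l, t, hl, ht, hlt, rfl⟩ := h
  have h1 := wedgeCovec_linear_combination l t c 0 0 1
  simp only [zero_smul, add_zero, one_smul, zero_add, mul_one, mul_zero, sub_zero] at h1
  exact ⟨c • l, t, ⟨smul_ne_zero hc hl.1, by simp [hl.2]⟩, ht, by simp [hlt], h1.symm⟩

theorem IsPartialKaehler.smul {n : ℕ} {ω : BilinForm ℝ (Fin n → ℝ)}
    {E : Submodule ℝ (Fin n → ℝ)} (h : IsPartialKaehler ω E) {c : ℝ} (hc : c ≠ 0) :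
    IsPartialKaehler (c • ω) E := by
  obtain ⟨hpos, hker, d, hd, J, hsq, hiso, hJ⟩ := h
  refine ⟨hpos, fun x hx => by rw [LinearMap.smul_apply, hker x hx, smul_zero], c * d,
    mul_ne_zero hc hd, J, hsq, hiso, fun x y => ?_⟩
  rw [LinearMap.smul_apply, LinearMap.smul_apply, hJ, smul_eq_mul, mul_assoc]

/-- Under a rigidity property of a form `η` whose stabilizer contains that of a form `ω` with maximal
stabilizer, `ω` is a nonzero multiple of `η`. -/
theorem HasMaximalStabilizer.exists_eq_smul {n : ℕ} (hn : 2 ≤ n)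
    {G : Subgroup ((Fin n → ℝ) ≃ₗ[ℝ] (Fin n → ℝ))} {ω η : BilinForm ℝ (Fin n → ℝ)}
    (hω : ω.IsAlt) (hω0 : ω ≠ 0) (hη : η.IsAlt) (hη' : HasCausalContractions η)
    (hmax : HasMaximalStabilizer G ω) (hle : G ⊓ formStabilizer ω ≤ G ⊓ formStabilizer η)
    (hrigid : ∀ ζ : BilinForm ℝ (Fin n → ℝ), ζ.IsAlt →
      G ⊓ formStabilizer η ≤ G ⊓ formStabilizer ζ → ∃ c : ℝ, ζ = c • η) :
    ∃ c : ℝ, c ≠ 0 ∧ ω = c • η := by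
  obtain ⟨c, rfl⟩ := hrigid ω hω (hmax.le_of_le hn hη hη' hle)
  exact ⟨c, fun h => hω0 (by rw [h, zero_smul]), rfl⟩

/-- Maximality forces the two stabilizers to coincide. This excludes exceptional `η` before
rigidity, which fails for them, is applied. -/
theorem HasMaximalStabilizer.of_le {n : ℕ} (hn : 2 ≤ n)
    {G : Subgroup ((Fin n → ℝ) ≃ₗ[ℝ] (Fin n → ℝ))} {ω η : BilinForm ℝ (Fin n → ℝ)}
    (hη : η.IsAlt) (hη' : HasCausalContractions η)
    (hmax : HasMaximalStabilizer G ω) (hle : G ⊓ formStabilizer ω ≤ G ⊓ formStabilizer η) :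
    HasMaximalStabilizer G η := by
  have heq := le_antisymm hle (hmax.le_of_le hn hη hη' hle)
  rwa [HasMaximalStabilizer, ← heq]

theorem isPartialKaehler_iff {n : ℕ} {ω : BilinForm ℝ (Fin n → ℝ)} :
    (∃ E, IsPartialKaehler ω E) ↔ IsTypeIIa ω ∨ IsTypeIIb ω := by
  simp only [isTypeIIa_iff, IsTypeIIb, isTypeIIbWith_iff]
  constructor
  · rintro ⟨E, hE⟩
    by_cases h : E = ⊥
    · exact Or.inl (h ▸ hE)
    · exact Or.inr ⟨E, h, hE⟩
  · rintro (h | ⟨E, -, h⟩)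
    exacts [⟨_, h⟩, ⟨E, h⟩]

theorem isPartialKaehler_finrank_ne_two_iff {n : ℕ} {ω : BilinForm ℝ (Fin n → ℝ)} :
    (∃ E : Submodule ℝ (Fin n → ℝ), Module.finrank ℝ E ≠ 2 ∧ IsPartialKaehler ω E) ↔
      IsTypeIIa ω ∨ ∃ E : Submodule ℝ (Fin n → ℝ), Module.finrank ℝ E ≠ 2 ∧ IsTypeIIbWith ω E := by
  simp only [isTypeIIa_iff, isTypeIIbWith_iff]
  constructor
  · rintro ⟨E, hd, hE⟩
    by_cases h : E = ⊥
    · exact Or.inl (h ▸ hE)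
    · exact Or.inr ⟨E, hd, h, hE⟩
  · rintro (h | ⟨E, hd, -, h⟩)
    exacts [⟨_, by simp, h⟩, ⟨E, hd, h⟩]

theorem corollaryc47 (n : ℕ) (hn : 2 ≤ n) (ω : LinearMap.BilinForm ℝ (Fin n → ℝ))
    (hω : ω.IsAlt) (hω0 : ω ≠ 0) :
    ((IsTypeIa ω ∨ IsTypeIb ω ∨ IsTypeIIa ω ∨ IsTypeIIb ω) ↔
      (HasCausalContractions ω ∧ HasMaximalStabilizer (pseudoO n) ω)) ∧
    ((IsTypeIa ω ∨ (IsTypeIb ω ∧ n ≠ 4) ∨ IsTypeIIa ω ∨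
        ∃ E : Submodule ℝ (Fin n → ℝ), Module.finrank ℝ E ≠ 2 ∧ IsTypeIIbWith ω E) ↔
      (HasCausalContractions ω ∧ HasMaximalStabilizer (pseudoSO n) ω)) := by
  have hSO : pseudoSO n ≤ pseudoO n := inf_le_left
  rw [← isPartialKaehler_iff, ← isPartialKaehler_finrank_ne_two_iff]
  refine ⟨⟨?_, ?_⟩, ⟨?_, ?_⟩⟩
  · rintro (h | h | ⟨E, h⟩)
    · exact ⟨h.hasCausalContractions, hasMaximalStabilizer_of_eq_smul fun η hη hle =>
        h.eq_smul_of_le le_rfl hSO hη hle⟩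
    · exact ⟨h.hasCausalContractions, hasMaximalStabilizer_of_eq_smul fun η hη hle =>
        h.eq_smul_of_le (Or.inl rfl) hη hle⟩
    · exact ⟨h.hasCausalContractions hω, hasMaximalStabilizer_of_eq_smul fun η hη hle =>
        h.eq_smul_of_le hn hω (Or.inl rfl) hη hle⟩
  · rintro ⟨hcausal, hmax⟩
    obtain ⟨η, hη, htype, hstab⟩ := exists_type_of_hasCausalContractions hn hω hω0 hcausal
    have hle := le_inf inf_le_left hstab
    obtain h | h | ⟨E, h⟩ := htype
    · obtain ⟨c, hc, rfl⟩ := hmax.exists_eq_smul hn hω hω0 hη h.hasCausalContractions hle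
        fun ζ hζ => h.eq_smul_of_le le_rfl hSO hζ
      exact Or.inl (h.smul hc)
    · obtain ⟨c, hc, rfl⟩ := hmax.exists_eq_smul hn hω hω0 hη h.hasCausalContractions hle
        fun ζ hζ => h.eq_smul_of_le (Or.inl rfl) hζ
      exact Or.inr (Or.inl (h.smul hc))
    · obtain ⟨c, hc, rfl⟩ := hmax.exists_eq_smul hn hω hω0 hη (h.hasCausalContractions hη) hle
        fun ζ hζ => h.eq_smul_of_le hn hη (Or.inl rfl) hζ
      exact Or.inr (Or.inr ⟨E, h.smul hc⟩)
  · rintro (h | ⟨h, h4⟩ | ⟨E, hE, h⟩)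
    · exact ⟨h.hasCausalContractions, hasMaximalStabilizer_of_eq_smul fun η hη hle =>
        h.eq_smul_of_le hSO le_rfl hη hle⟩
    · exact ⟨h.hasCausalContractions, hasMaximalStabilizer_of_eq_smul fun η hη hle =>
        h.eq_smul_of_le (Or.inr ⟨rfl, h4⟩) hη hle⟩
    · exact ⟨h.hasCausalContractions hω, hasMaximalStabilizer_of_eq_smul fun η hη hle =>
        h.eq_smul_of_le hn hω (Or.inr ⟨rfl, hE⟩) hη hle⟩
  · rintro ⟨hcausal, hmax⟩
    obtain ⟨η, hη, htype, hstab⟩ := exists_type_of_hasCausalContractions hn hω hω0 hcausal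
    have hle := le_inf inf_le_left ((inf_le_inf_right _ hSO).trans hstab)
    obtain h | h | ⟨E, h⟩ := htype
    · obtain ⟨c, hc, rfl⟩ := hmax.exists_eq_smul hn hω hω0 hη h.hasCausalContractions hle
        fun ζ hζ => h.eq_smul_of_le hSO le_rfl hζ
      exact Or.inl (h.smul hc)
    · have h4 : n ≠ 4 := by
        rintro rfl
        exact h.not_hasMaximalStabilizer (hmax.of_le hn hη h.hasCausalContractions hle)
      obtain ⟨c, hc, rfl⟩ := hmax.exists_eq_smul hn hω hω0 hη h.hasCausalContractions hle
        fun ζ hζ => h.eq_smul_of_le (Or.inr ⟨rfl, h4⟩) hζ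
      exact Or.inr (Or.inl ⟨h.smul hc, h4⟩)
    · have hE : Module.finrank ℝ E ≠ 2 := fun hE =>
        h.not_hasMaximalStabilizer hn hη hE (hmax.of_le hn hη (h.hasCausalContractions hη) hle)
      obtain ⟨c, hc, rfl⟩ := hmax.exists_eq_smul hn hω hω0 hη (h.hasCausalContractions hη) hle
        fun ζ hζ => h.eq_smul_of_le hn hη (Or.inr ⟨rfl, hE⟩) hζ
      exact Or.inr (Or.inr ⟨E, hE, h.smul hc⟩)
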